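/- Let $A$ be a finite dimensional algebra over a field $k$, and let $\operatorname{mod}A$ be the category of finitely generated left $A$-modules. A module $G$ in $\operatorname{mod}A$ is Gorenstein-projective if $G\cong\operatorname{Ker}d^0$ for some exact complex $\cdots\to P^{-1}\to P^0\xrightarrow{d^0}P^1\to\cdots$ of projective modules in $\operatorname{mod}A$ that stays exact under $\operatorname{Hom}_A(-,P)$ for every projective $P$ in $\operatorname{mod}A$; write $\operatorname{Gproj}A$ for the class of these modules. A short exact sequence in $\operatorname{mod}A$ is $G$-exact if it stays exact under $\operatorname{Hom}_A(G,-)$ for every $G\in\operatorname{Gproj}A$. Let $D^b_{gp}(A)=K^b(A)/K^b_{gpac}(A)$ be the Verdier quotient of the bounded homotopy category $K^b(A)$ of $\operatorname{mod}A$ by the complexes $X^\bullet$ such that $\operatorname{Hom}_A(G,X^\bullet)$ is acyclic for all $G\in\operatorname{Gproj}A$. Modules are regarded as complexes concentrated in degree $0$. Let $G^\bullet: G_1\xrightarrow{\theta}G_0$ (with $G_0$ in degree $0$ and $G_1$ in degree $-1$) be a 2-term Gorenstein silting complex, that is, $G_0,G_1\in\operatorname{Gproj}A$ and (i) $G_1\to\operatorname{Im}\theta$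 and $G_0\to\operatorname{Coker}\theta$ are right $\operatorname{Gproj}A$-approximations (every morphism from a module in $\operatorname{Gproj}A$ to the target factors through them); (ii) $\operatorname{Hom}_{D^b_{gp}(A)}(G^\bullet,G^\bullet[1])=0$; (iii) the smallest triangulated subcategory of $D^b_{gp}(A)$ that contains $G^\bullet$ and is closed under direct summands and isomorphisms is $K^b(\operatorname{Gproj}A)$, i.e. consists exactly of the objects isomorphic in $D^b_{gp}(A)$ to bounded complexes with all terms in $\operatorname{Gproj}A$. Put $H^0(G^\bullet)=\operatorname{Coker}\theta$, let $\operatorname{add}H^0(G^\bullet)$ be the class of direct summands of finite direct sums of copies of $H^0(G^\bullet)$, and let $$\mathcal T(G^\bullet)=\{X\in\operatorname{mod}A\mid \operatorname{Hom}_{D^b_{gp}(A)}(G^\bullet,X[1])=0\}.$$ A module $X$ is called Ext-projective in $\mathcal T(G^\bullet)$ if $X\in\mathcal T(G^\bullet)$ and $\operatorname{Hom}_{D^b_{gp}(A)}(X,Y[1])=0$ for all $Y\in\mathcal T(G^\bullet)$. Then: (1) For every $X\in\operatorname{mod}A$, $X\in\operatorname{add}H^0(G^\bullet)$ if and only if $X$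 is Ext-projective in $\mathcal T(G^\bullet)$. (2) For every $X\in\mathcal T(G^\bullet)$ there is a $G$-exact sequence $0\to L\to T_0\to X\to 0$ with $T_0\in\operatorname{add}H^0(G^\bullet)$ and $L\in\mathcal T(G^\bullet)$. -/

import Mathlib

open CategoryTheory Limits Pretriangulated Opposite ZeroObject

universe u

noncomputable section

namespace GorensteinSilting

/-! ### Finitely generated modules -/

instance isFG_isClosedUnderFiniteProducts (A : Type u) [Ring A] :
    (ModuleCat.isFG.{u} A).IsClosedUnderFiniteProducts := by
  have : (ModuleCat.isFG.{u} A).IsClosedUnderIsomorphisms :=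
    ⟨fun e (h : Module.Finite A _) => Module.Finite.equiv e.toLinearEquiv⟩
  have : (ModuleCat.isFG.{u} A).IsClosedUnderBinaryProducts := by
    refine ⟨?_⟩
    rintro X ⟨p⟩
    have h1 : Module.Finite A (p.diag.obj ⟨.left⟩) := p.prop_diag_obj ⟨.left⟩
    have h2 : Module.Finite A (p.diag.obj ⟨.right⟩) := p.prop_diag_obj ⟨.right⟩
    let e := IsLimit.conePointUniqueUpToIso
      ((IsLimit.postcomposeHomEquiv (diagramIsoPair p.diag) _).2 p.isLimit)
      (ModuleCat.binaryProductLimitCone (p.diag.obj ⟨.left⟩) (p.diag.obj ⟨.right⟩)).isLimit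
    have h3 : Module.Finite A
        ((p.diag.obj ⟨.left⟩ : ModuleCat.{u} A) × (p.diag.obj ⟨.right⟩ : ModuleCat.{u} A)) :=
      @Module.Finite.prod A _ _ _ _ _ _ _ h1 h2
    exact (ModuleCat.isFG.{u} A).prop_of_iso e.symm h3
  have : (ModuleCat.isFG.{u} A).ContainsZero :=
    ⟨ModuleCat.of A PUnit.{u + 1}, ModuleCat.isZero_of_subsingleton _,
      (inferInstance : Module.Finite A PUnit.{u + 1})⟩
  exact .mk'

instance fgModuleCat_hasFiniteProducts (A : Type u) [Ring A] :
    HasFiniteProducts (FGModuleCat.{u} A) := inferInstance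

instance fgModuleCat_hasFiniteBiproducts (A : Type u) [Ring A] :
    HasFiniteBiproducts (FGModuleCat.{u} A) := HasFiniteBiproducts.of_hasFiniteProducts

instance fgModuleCat_hasBinaryBiproducts (A : Type u) [Ring A] :
    HasBinaryBiproducts (FGModuleCat.{u} A) := hasBinaryBiproducts_of_finite_biproducts _


/-! ### Bounded complexes up to homotopy -/

section Bounded

variable (C : Type*) [Category* C] [Preadditive C]

/-- The objects of the homotopy category whose underlying complex is bounded. -/
def bounded : ObjectProperty (HomotopyCategory C (ComplexShape.up ℤ)) :=
  fun K => ∃ a b : ℤ, ∀ i : ℤ, i < a ∨ b < i → IsZero (K.as.X i)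

instance [HasZeroObject C] : (bounded C).ContainsZero where
  exists_zero :=
    ⟨(HomotopyCategory.quotient _ _).obj 0, Functor.map_isZero _ (isZero_zero _),
      0, 0, fun i _ => (HomologicalComplex.eval C (ComplexShape.up ℤ) i).map_isZero
        (isZero_zero _)⟩

instance : (bounded C).IsStableUnderShift ℤ where
  isStableUnderShiftBy n :=
    { le_shift := by
        intro K hK
        obtain ⟨K : CochainComplex _ _, rfl⟩ := K.quotient_obj_surjective
        obtain ⟨a, b, h⟩ := hK
        rw [ObjectProperty.prop_shift_iff, HomotopyCategory.shift_quotient_obj]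
        exact ⟨a - n, b - n, fun i hi => h (i + n) (by lia)⟩ }

instance [HasZeroObject C] [HasBinaryBiproducts C] :
    (bounded C).IsTriangulatedClosed₃ where
  ext₃' T hT h₁ h₂ := by
    obtain ⟨a₁, b₁, h₁⟩ := h₁
    obtain ⟨a₂, b₂, h₂⟩ := h₂
    obtain ⟨f : T.obj₁.as ⟶ T.obj₂.as, hf⟩ :=
      (HomotopyCategory.quotient _ _).map_surjective T.mor₁
    refine ⟨_, ?_,
      ⟨Triangle.π₃.mapIso (isoTriangleOfIso₁₂ T _ hT
        (HomotopyCategory.mappingCone_triangleh_distinguished f)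
        (Iso.refl _) (Iso.refl _) ?_)⟩⟩
    · refine ⟨min (a₁ - 1) a₂, max b₁ b₂, fun i hi => ?_⟩
      refine (CochainComplex.mappingCone.isZero_X_iff f i).2
        ⟨h₁ _ (by lia), h₂ _ (by lia)⟩
    · exact (Category.comp_id _).trans (hf.symm.trans (Category.id_comp _).symm)

instance [HasZeroObject C] [HasBinaryBiproducts C] : (bounded C).IsTriangulated where
  toIsTriangulatedClosed₂ := .of_isTriangulatedClosed₃

end Bounded

/-! ### Gorenstein-projective modules -/

section Modules

variable (A : Type u) [Ring A]

/-- `G` is Gorenstein-projective: there is an exact complex `P` of finitely generated projective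
modules which stays exact under `Hom_A(-, Q)` for all finitely generated projective `Q`, such that
`G` is isomorphic to the kernel of `d⁰ : P⁰ ⟶ P¹`. -/
def gproj : ObjectProperty (FGModuleCat.{u} A) := fun G =>
  ∃ P : CochainComplex (FGModuleCat.{u} A) ℤ,
    (∀ n : ℤ, Module.Projective A (P.X n)) ∧
    (∀ n : ℤ, Function.Exact (P.d (n - 1) n).hom.hom (P.d n (n + 1)).hom.hom) ∧
    (∀ Q : FGModuleCat.{u} A, Module.Projective A Q → ∀ n : ℤ,
      Function.Exact (fun f : P.X (n + 1) ⟶ Q => P.d n (n + 1) ≫ f)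
        (fun f : P.X n ⟶ Q => P.d (n - 1) n ≫ f)) ∧
    Nonempty (G ≃ₗ[A] LinearMap.ker (P.d 0 1).hom.hom)

variable {A}

/-- `f : X ⟶ M` is a right `P`-approximation of `M`. -/
def IsRightApproximation (P : ObjectProperty (FGModuleCat.{u} A)) {X M : FGModuleCat.{u} A}
    (f : X ⟶ M) : Prop :=
  P X ∧ ∀ (Y : FGModuleCat.{u} A), P Y → ∀ g : Y ⟶ M, ∃ h : Y ⟶ X, h ≫ f = g

/-- The sequence `0 ⟶ X ⟶ Y ⟶ Z ⟶ 0` is exact, and stays so under `Hom_A(G, -)` for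
every Gorenstein-projective module `G`. -/
def IsGExact {X Y Z : FGModuleCat.{u} A} (f : X ⟶ Y) (g : Y ⟶ Z) : Prop :=
  (Function.Injective f.hom.hom ∧ Function.Exact f.hom.hom g.hom.hom ∧
    Function.Surjective g.hom.hom) ∧
  ∀ G : FGModuleCat.{u} A, gproj A G →
    Function.Injective (fun h : G ⟶ X => h ≫ f) ∧
    Function.Exact (fun h : G ⟶ X => h ≫ f) (fun h : G ⟶ Y => h ≫ g) ∧
    Function.Surjective (fun h : G ⟶ Y => h ≫ g)

/-- `add T`: the direct summands of finite direct sums of copies of `T`. -/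
def addClosure (T : FGModuleCat.{u} A) : ObjectProperty (FGModuleCat.{u} A) := fun X =>
  ∃ n : ℕ, Nonempty (Retract X (FGModuleCat.of A (Fin n → T)))

/-! ### The bounded Gorenstein derived category -/

variable (A)

/-- `K^b(A)`, the homotopy category of bounded complexes of finitely generated modules. -/
abbrev Kb : Type (u + 1) := (bounded (FGModuleCat.{u} A)).FullSubcategory

/-- The functor `Hom_A(G, -)` from `K^b(A)` to complexes of abelian groups up to homotopy. -/
abbrev homFrom (G : FGModuleCat.{u} A) :
    Kb A ⥤ HomotopyCategory AddCommGrpCat.{u} (ComplexShape.up ℤ) :=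
  (bounded (FGModuleCat.{u} A)).ι ⋙
    (preadditiveCoyoneda.obj (op G)).mapHomotopyCategory (ComplexShape.up ℤ)

/-- The bounded complexes `X` such that `Hom_A(G, X)` is acyclic for every
Gorenstein-projective `G`. -/
def gpAcyclic : ObjectProperty (Kb A) := fun X =>
  ∀ G : FGModuleCat.{u} A, gproj A G →
    (HomotopyCategory.subcategoryAcyclic AddCommGrpCat.{u}) ((homFrom A G).obj X)

instance : (gpAcyclic A).IsClosedUnderIsomorphisms where
  of_iso e h G hG := ObjectProperty.prop_of_iso _ ((homFrom A G).mapIso e) (h G hG)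

instance : (gpAcyclic A).IsTriangulated where
  exists_zero := ⟨0, isZero_zero _, fun G _ =>
    ObjectProperty.prop_of_isZero _ ((homFrom A G).map_isZero (isZero_zero _))⟩
  isStableUnderShiftBy n :=
    { le_shift := fun X h G hG =>
        ((HomotopyCategory.subcategoryAcyclic AddCommGrpCat.{u}).inverseImage
          (homFrom A G)).le_shift n X (h G hG) }
  toIsTriangulatedClosed₂ := .mk' fun T hT h₁ h₃ G hG =>
    ((HomotopyCategory.subcategoryAcyclic AddCommGrpCat.{u}).inverseImage
      (homFrom A G)).ext_of_isTriangulatedClosed₂ T hT (h₁ G hG) (h₃ G hG)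

/-- The bounded Gorenstein derived category `D^b_gp(A)`: the Verdier quotient of `K^b(A)` by the
bounded complexes that are acyclic under `Hom_A(G, -)` for all Gorenstein-projective `G`. -/
abbrev Dgp : Type (u + 1) := (gpAcyclic A).trW.Localization

/-- The quotient functor `K^b(A) ⥤ D^b_gp(A)`. -/
abbrev Qgp : Kb A ⥤ Dgp A := (gpAcyclic A).trW.Q


variable {A}

/-- A finitely generated module, as an object of `D^b_gp(A)`: a complex in degree `0`. -/
def ofModule (X : FGModuleCat.{u} A) : Dgp A :=
  (Qgp A).obj ⟨(HomotopyCategory.quotient _ _).obj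
    ((HomologicalComplex.single (FGModuleCat.{u} A) (ComplexShape.up ℤ) 0).obj X),
    0, 0, fun i hi => HomologicalComplex.isZero_single_obj_X _ _ _ _ (by lia)⟩

variable {G₁ G₀ : FGModuleCat.{u} A}

lemma rel_neg_one_zero : (ComplexShape.up ℤ).Rel (-1) 0 := by simp

/-- The complex `G₁ ⟶ G₀`, with `G₀` in degree `0` and `G₁` in degree `-1`, as an object
of `D^b_gp(A)`. -/
def twoTerm (θ : G₁ ⟶ G₀) : Dgp A :=
  (Qgp A).obj ⟨(HomotopyCategory.quotient _ _).obj
    (HomologicalComplex.double θ rel_neg_one_zero),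
    -1, 0, fun i hi => HomologicalComplex.isZero_double_X θ rel_neg_one_zero i (by lia) (by lia)⟩

/-- `K^b(Gproj A)` inside `D^b_gp(A)`: the objects isomorphic to a bounded complex whose terms are
all Gorenstein-projective. -/
def kbGproj : ObjectProperty (Dgp A) := fun X =>
  ∃ K : Kb A, (∀ i : ℤ, gproj A (K.obj.as.X i)) ∧ Nonempty (X ≅ (Qgp A).obj K)

/-! ### Two-term Gorenstein silting complexes -/

/-- The canonical morphism from `G₁` to the image of `θ : G₁ ⟶ G₀`. -/
def toImage (θ : G₁ ⟶ G₀) : G₁ ⟶ FGModuleCat.of A (LinearMap.range θ.hom.hom) :=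
  FGModuleCat.ofHom θ.hom.hom.rangeRestrict

/-- `H⁰` of the complex `θ : G₁ ⟶ G₀`, that is, the cokernel of `θ`. -/
def H0 (θ : G₁ ⟶ G₀) : FGModuleCat.{u} A :=
  FGModuleCat.of A (G₀ ⧸ LinearMap.range θ.hom.hom)

/-- The canonical morphism from `G₀` to the cokernel of `θ : G₁ ⟶ G₀`. -/
def toH0 (θ : G₁ ⟶ G₀) : G₀ ⟶ H0 θ :=
  FGModuleCat.ofHom (LinearMap.range θ.hom.hom).mkQ

/-- The complex `θ : G₁ ⟶ G₀` is 2-term partial Gorenstein silting. -/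
structure IsPartialGorensteinSilting (θ : G₁ ⟶ G₀) : Prop where
  gproj₁ : gproj A G₁
  gproj₀ : gproj A G₀
  approx₁ : IsRightApproximation (gproj A) (toImage θ)
  approx₀ : IsRightApproximation (gproj A) (toH0 θ)
  hom_shift_eq_zero : ∀ f : twoTerm θ ⟶ (twoTerm θ)⟦(1 : ℤ)⟧, f = 0

/-- The complex `θ : G₁ ⟶ G₀` is 2-term Gorenstein silting: it is partial Gorenstein silting, and
the smallest triangulated subcategory of `D^b_gp(A)` that contains it and is closed under direct
summands is `K^b(Gproj A)`. -/
structure IsGorensteinSilting (θ : G₁ ⟶ G₀) : Prop extends IsPartialGorensteinSilting θ where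
  thick_eq : (ObjectProperty.singleton (twoTerm θ)).triangEnvelope = kbGproj (A := A)

/-- The modules `X` with `Hom(G, X[1]) = 0` in `D^b_gp(A)`, for the complex `G` given by `θ`. -/
def torsionClass (θ : G₁ ⟶ G₀) : ObjectProperty (FGModuleCat.{u} A) := fun X =>
  ∀ f : twoTerm θ ⟶ (ofModule X)⟦(1 : ℤ)⟧, f = 0

/-- `X` is Ext-projective in the class `P`: it lies in `P` and `Hom(X, Y[1]) = 0` in `D^b_gp(A)`
(that is, the relative extension group `Gext¹(X, Y)` vanishes) for all `Y` in `P`. -/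
def IsExtProjective (P : ObjectProperty (FGModuleCat.{u} A)) (X : FGModuleCat.{u} A) : Prop :=
  P X ∧ ∀ Y : FGModuleCat.{u} A, P Y → ∀ f : ofModule X ⟶ (ofModule Y)⟦(1 : ℤ)⟧, f = 0

end Modules

end GorensteinSilting

end

/-! Write `G•` for the complex given by `θ`. A Gorenstein-projective module `G` is left orthogonal
to the complexes killed in the Verdier quotient, so `Hom(G, K[n])` in `D^b_gp(A)` is the `n`-th
cohomology of `Hom_A(G, K)`. For a module `X` this leaves only `Hom_A(G, X)` in degree zero, and the
triangle `G₁ ⟶ G₀ ⟶ G•` shows that membership of `X` in the torsion class already forces `Hom(G•,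
X[i]) = 0` for all `i > 0`.

Ext-projectivity of `H⁰`: by the two approximation conditions the cone `Z` of `G• ⟶ H⁰` satisfies
`Hom(G, Z[n]) = 0` for all `n ≥ -1` (`exists_toH0_triangle`). A truncation argument then gives
`Hom(Z, Y[1]) = 0` for every module `Y` (`hom_ofModule_eq_zero`), so the vanishing of `Hom(G•,
Y[1])` passes to `H⁰`.

The `G`-exact sequence: choose finitely many morphisms `G• ⟶ X` generating all others over the
endomorphisms of `G•`. They factor through `H⁰` and define `p : (H⁰)ⁿ ⟶ X`. The crucial point is
that every morphism `G ⟶ X` lifts along `p`. The obstruction lies in `Hom(G, X'[1])`, where `X'`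
completes `(G•)ⁿ ⟶ X` to a triangle. Repeated approximation embeds it in groups of ever higher
degree, which vanish eventually because `G` lies in the thick subcategory generated by `G•`
(`homZero_one_of_triangEnvelope`). The kernel of `p` is in the torsion class by the choice of
generators.

If `X` is Ext-projective, the triangle of this sequence splits, and the splitting descends to
modules because elements of a module are morphisms from `A`. So `X` is a summand of `T₀`. -/

noncomputable section

namespace GorensteinSilting

/-! ### Vanishing of graded morphisms in pretriangulated categories -/

section HomZero

variable {C : Type*} [Category* C] [Preadditive C] [HasShift C ℤ]

/-- All morphisms of degree `n` from `X` to `Y` vanish. -/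
def HomZero (X Y : C) (n : ℤ) : Prop := ∀ f : X ⟶ Y⟦n⟧, f = 0

lemma HomZero.map_iff {D : Type*} [Category* D] [Preadditive D] [HasShift D ℤ]
    (F : C ⥤ D) [F.CommShift ℤ] [F.Additive] {X Y : C} {n : ℤ}
    (hF : Function.Bijective (F.map : (X ⟶ Y⟦n⟧) → _)) :
    HomZero (F.obj X) (F.obj Y) n ↔ HomZero X Y n := by
  constructor
  · intro h f
    apply hF.1
    rw [F.map_zero, ← cancel_mono ((F.commShiftIso n).hom.app Y), zero_comp]
    exact h _
  · intro h f
    obtain ⟨g, hg⟩ := hF.2 (f ≫ (F.commShiftIso n).inv.app Y)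
    rw [← cancel_mono ((F.commShiftIso n).inv.app Y), ← hg, h g, F.map_zero, zero_comp]

lemma HomZero.of_iso_right {X Y Y' : C} {n : ℤ} (h : HomZero X Y n) (e : Y ≅ Y') :
    HomZero X Y' n := fun f => by
  rw [← cancel_mono ((shiftFunctor C n).mapIso e.symm).hom, zero_comp]
  exact h _

lemma HomZero.of_retract_left {X X' Y : C} {n : ℤ} (h : HomZero X Y n) (e : Retract X' X) :
    HomZero X' Y n := fun f => by
  rw [← Category.id_comp f, ← e.retract, Category.assoc, h (e.r ≫ f), comp_zero]

lemma homZero_zero_iff {X Y : C} : HomZero X Y 0 ↔ ∀ f : X ⟶ Y, f = 0 := by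
  constructor
  · intro h f
    rw [← cancel_mono ((shiftFunctorZero C ℤ).inv.app Y), zero_comp]
    exact h _
  · intro h f
    rw [← cancel_mono ((shiftFunctorZero C ℤ).hom.app Y), zero_comp]
    exact h _

lemma homZero_shift_right {X Y : C} {a n m : ℤ} (hm : a + n = m) :
    HomZero X (Y⟦a⟧) n ↔ HomZero X Y m := by
  constructor
  · intro h f
    rw [← cancel_mono ((shiftFunctorAdd' C a n m hm).hom.app Y), zero_comp]
    exact h _
  · intro h f
    rw [← cancel_mono ((shiftFunctorAdd' C a n m hm).inv.app Y), zero_comp]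
    exact h _

lemma HomZero.of_retract_right {X Y Y' : C} {n : ℤ} (h : HomZero X Y n) (e : Retract Y' Y) :
    HomZero X Y' n := fun f => by
  have : e.i⟦n⟧' ≫ e.r⟦n⟧' = 𝟙 _ := by rw [← Functor.map_comp, e.retract, CategoryTheory.Functor.map_id]
  rw [← Category.comp_id f, ← this, ← Category.assoc, h (f ≫ e.i⟦n⟧'), zero_comp]

variable [∀ n : ℤ, (shiftFunctor C n).Additive]

lemma homZero_shift_shift {X Y : C} {a n : ℤ} :
    HomZero (X⟦a⟧) (Y⟦a⟧) n ↔ HomZero X Y n := by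
  rw [homZero_shift_right (add_comm a n)]
  constructor
  · intro h f
    apply (shiftFunctor C a).map_injective
    rw [Functor.map_zero, ← cancel_mono ((shiftFunctorAdd C n a).inv.app Y), zero_comp]
    exact h _
  · intro h f
    obtain ⟨g, hg⟩ := (shiftFunctor C a).map_surjective (f ≫ (shiftFunctorAdd C n a).hom.app Y)
    rw [← cancel_mono ((shiftFunctorAdd C n a).hom.app Y), ← hg, h g, Functor.map_zero, zero_comp]

lemma homZero_shift_left {X Y : C} {a n m : ℤ} (hm : a + m = n) :
    HomZero (X⟦a⟧) Y n ↔ HomZero X Y m := by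
  rw [← homZero_shift_right (Y := Y) hm, homZero_shift_shift]

/-- If `Hom(X, Y) = 0` in degree `n` then so it is with `Y` replaced by a finite sum of copies. -/
lemma HomZero.biproduct {J : Type} [Finite J] {X : C} {Y : J → C} [HasBiproduct Y] {n : ℤ}
    (h : ∀ j, HomZero X (Y j) n) : HomZero X (⨁ Y) n := fun f => by
  have := Fintype.ofFinite J
  have h1 : ∑ j, (biproduct.π Y j ≫ biproduct.ι Y j)⟦n⟧' = 𝟙 ((⨁ Y)⟦n⟧) := by
    rw [← Functor.map_sum, biproduct.total, CategoryTheory.Functor.map_id]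
  rw [← Category.comp_id f, ← h1, Preadditive.comp_sum]
  refine Finset.sum_eq_zero fun j _ => ?_
  rw [Functor.map_comp, ← Category.assoc, h j (f ≫ (biproduct.π Y j)⟦n⟧'), zero_comp]

variable [HasZeroObject C] [Pretriangulated C]

/-- Exactness of `Hom(X, -)` at the middle term; the variants for the outer terms follow by
rotation, which accounts for their change of degree. -/
lemma HomZero.of_dist₂ {T : Triangle C} (hT : T ∈ distTriang C) {X : C} {n : ℤ}
    (h₁ : HomZero X T.obj₁ n) (h₃ : HomZero X T.obj₃ n) : HomZero X T.obj₂ n := fun f => by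
  obtain ⟨g, hg⟩ := Triangle.coyoneda_exact₂ _ (Triangle.shift_distinguished _ hT n) f (h₃ _)
  rw [hg, h₁ g]
  exact zero_comp

lemma HomZero.of_dist₃ {T : Triangle C} (hT : T ∈ distTriang C) {X : C} {n m : ℤ}
    (hm : 1 + n = m) (h₂ : HomZero X T.obj₂ n) (h₁ : HomZero X T.obj₁ m) :
    HomZero X T.obj₃ n :=
  HomZero.of_dist₂ (rot_of_distTriang _ hT) h₂ ((homZero_shift_right hm).2 h₁)

lemma HomZero.of_dist₁ {T : Triangle C} (hT : T ∈ distTriang C) {X : C} {n m : ℤ}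
    (hm : -1 + m = n) (h₂ : HomZero X T.obj₂ m) (h₃ : HomZero X T.obj₃ n) :
    HomZero X T.obj₁ m :=
  HomZero.of_dist₂ (inv_rot_of_distTriang _ hT) ((homZero_shift_right hm).2 h₃) h₂

lemma HomZero.dist₂ {T : Triangle C} (hT : T ∈ distTriang C) {Y : C} {n : ℤ}
    (h₁ : HomZero T.obj₁ Y n) (h₃ : HomZero T.obj₃ Y n) : HomZero T.obj₂ Y n := fun f => by
  obtain ⟨g, hg⟩ := Triangle.yoneda_exact₂ _ hT f (h₁ _)
  rw [hg, h₃ g, comp_zero]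

lemma HomZero.dist₃ {T : Triangle C} (hT : T ∈ distTriang C) {Y : C} {n m : ℤ}
    (hm : 1 + n = m) (h₁ : HomZero T.obj₁ Y n) (h₂ : HomZero T.obj₂ Y m) :
    HomZero T.obj₃ Y m :=
  HomZero.dist₂ (rot_of_distTriang _ hT) h₂ ((homZero_shift_left hm).2 h₁)

end HomZero

/-! ### Morphisms in the homotopy category from and to complexes in degree zero -/

section HomotopyCategory

variable {C : Type*} [Category* C] [Preadditive C] [HasZeroObject C]

open CochainComplex HomComplex

/-- In the Hom complex out of an object in degree zero, `n`-cocycles are the morphisms to `Kⁿ`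
killed by `d`, and coboundaries are those that factor through `d`. -/
lemma homZero_single_left_iff (X : C) (K : CochainComplex C ℤ) (n : ℤ) :
    HomZero ((HomotopyCategory.singleFunctor C 0).obj X)
      ((HomotopyCategory.quotient C (ComplexShape.up ℤ)).obj K) n ↔
    ∀ x : X ⟶ K.X n, x ≫ K.d n (n + 1) = 0 → ∃ y : X ⟶ K.X (n - 1), y ≫ K.d (n - 1) n = x := by
  constructor
  · intro h x hx
    let c := Cocycle.fromSingleMk x (zero_add n) (n + 1) rfl hx
    have h0 : CohomologyClass.toHom (CohomologyClass.mk c) = 0 := by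
      rw [← cancel_mono ((HomotopyCategory.quotient C (ComplexShape.up ℤ)).commShiftIso n |>.hom.app
        K), zero_comp]
      exact h _
    rw [CohomologyClass.toHom_mk_eq_zero_iff] at h0
    exact (Cocycle.fromSingleMk_mem_coboundaries_iff x _ _ _ hx (n - 1) (by lia)).1 h0
  · intro h f
    obtain ⟨c, hc⟩ := (CohomologyClass.toHom_bijective
      ((CochainComplex.singleFunctor C 0).obj X) K n).2
        (f ≫ ((HomotopyCategory.quotient C (ComplexShape.up ℤ)).commShiftIso n).inv.app K)
    obtain ⟨c, rfl⟩ := c.mk_surjective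
    obtain ⟨x, hx, rfl⟩ := Cocycle.fromSingleMk_surjective c n (zero_add n) (n + 1) rfl
    have := (CohomologyClass.toHom_mk_eq_zero_iff _).2
      ((Cocycle.fromSingleMk_mem_coboundaries_iff x (zero_add n) (n + 1) rfl hx (n - 1)
        (by lia)).2 (h x hx))
    rw [this] at hc
    rw [← cancel_mono (((HomotopyCategory.quotient C (ComplexShape.up ℤ)).commShiftIso n).inv.app K)]
    exact hc.symm.trans zero_comp.symm

lemma homZero_single_single (X Y : C) {n : ℤ} (hn : n ≠ 0) :
    HomZero ((HomotopyCategory.singleFunctor C 0).obj X)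
      ((HomotopyCategory.singleFunctor C 0).obj Y) n := by
  refine (homZero_single_left_iff X ((CochainComplex.singleFunctor C 0).obj Y) n).2 fun x _ => ?_
  refine ⟨0, (HomologicalComplex.isZero_single_obj_X _ _ _ _ hn).eq_of_tgt _ _⟩

lemma singleFunctor_map_bijective (X Y : C) :
    Function.Bijective ((HomotopyCategory.singleFunctor C 0).map : (X ⟶ Y) → _) := by
  constructor
  · refine (injective_iff_map_eq_zero (Functor.mapAddHom (X := X) (Y := Y)
      (HomotopyCategory.singleFunctor C 0))).2 fun f h => ?_
    have h' : (HomotopyCategory.quotient C (ComplexShape.up ℤ)).map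
      ((CochainComplex.singleFunctor C 0).map f) = 0 := h
    rw [HomotopyCategory.quotient_map_eq_zero_iff] at h'
    apply (CochainComplex.singleFunctor C 0).map_injective
    obtain ⟨h'⟩ := h'
    have h0 := h'.comm 0
    rw [Functor.map_zero]
    ext i
    by_cases hi : i = 0
    · subst hi
      simpa [dNext, prevD] using h0
    · exact (HomologicalComplex.isZero_single_obj_X _ _ _ _ hi).eq_of_src _ _
  · intro f
    obtain ⟨g, hg⟩ := (HomotopyCategory.quotient C (ComplexShape.up ℤ)).map_surjective
      (X := (CochainComplex.singleFunctor C 0).obj X)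
      (Y := (CochainComplex.singleFunctor C 0).obj Y) f
    obtain ⟨h, rfl⟩ := (CochainComplex.singleFunctor C 0).map_surjective g
    exact ⟨h, hg⟩

end HomotopyCategory

/-! ### Two-term complexes as mapping cones -/

section Double

variable {C : Type*} [Category* C] [Preadditive C] [HasZeroObject C]

open CochainComplex HomComplex

variable {X Y : C} (θ : X ⟶ Y)

lemma neg_one_ne_zero_int : (-1 : ℤ) ≠ 0 := by decide

/-- The term of degree zero of a complex concentrated in degree zero. -/
def singleXIso (Z : C) : ((CochainComplex.singleFunctor C 0).obj Z).X 0 ≅ Z :=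
  HomologicalComplex.singleObjXSelf (.up ℤ) 0 Z

lemma singleFunctor_map_f_zero :
    ((CochainComplex.singleFunctor C 0).map θ).f 0 =
      (singleXIso X).hom ≫ θ ≫ (singleXIso Y).inv :=
  HomologicalComplex.single_map_f_self _ _ _

variable [HasBinaryBiproducts C]

/-- The comparison morphism from the complex `X ⟶ Y` to the mapping cone of the morphism between
complexes concentrated in degree zero. -/
def doubleToMappingCone :
    HomologicalComplex.double θ rel_neg_one_zero ⟶
      mappingCone ((CochainComplex.singleFunctor C 0).map θ) :=
  HomologicalComplex.mkHomFromDouble rel_neg_one_zero neg_one_ne_zero_int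
    ((singleXIso X).inv ≫
      (mappingCone.inl ((CochainComplex.singleFunctor C 0).map θ)).v 0 (-1) (by lia))
    ((singleXIso Y).inv ≫
      (mappingCone.inr ((CochainComplex.singleFunctor C 0).map θ)).f 0)
    (by
      rw [Category.assoc, mappingCone.inl_v_d _ 0 (-1) 1 (by lia) (by lia)]
      simp only [CochainComplex.singleFunctor_obj_d, zero_comp, sub_zero]
      rw [singleFunctor_map_f_zero]
      simp)
    (by
      intro k _
      rw [Category.assoc, mappingCone.inr_f_d]
      simp only [CochainComplex.singleFunctor_obj_d, zero_comp, comp_zero])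

/-- In each degree at least one of the two summands of the cone is zero, so `inl` or `inr` is
invertible there, or both sides vanish. -/
instance : IsIso (doubleToMappingCone θ) := by
  set φ := (CochainComplex.singleFunctor C 0).map θ with hφ
  have hX : ∀ i : ℤ, i ≠ 0 → IsZero (((CochainComplex.singleFunctor C 0).obj X).X i) :=
    fun i hi => HomologicalComplex.isZero_single_obj_X _ _ _ _ hi
  have hY : ∀ i : ℤ, i ≠ 0 → IsZero (((CochainComplex.singleFunctor C 0).obj Y).X i) :=
    fun i hi => HomologicalComplex.isZero_single_obj_X _ _ _ _ hi
  have : ∀ i, IsIso ((doubleToMappingCone θ).f i) := by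
    intro i
    by_cases h₁ : i = -1
    · subst h₁
      have hid := mappingCone.id_X φ (-1) 0 (by lia)
      have h0 : (mappingCone.snd φ).v (-1) (-1) (add_zero _) = 0 := (hY _ (by lia)).eq_of_tgt _ _
      rw [h0, zero_comp, add_zero] at hid
      refine ⟨(mappingCone.fst φ).1.v (-1) 0 (by lia) ≫
        (singleXIso X).hom ≫
        (HomologicalComplex.doubleXIso₀ θ rel_neg_one_zero).inv, ?_, ?_⟩
      · simp [doubleToMappingCone, φ]
      · simpa [doubleToMappingCone, φ] using hid
    by_cases h₂ : i = 0
    · subst h₂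
      have hid := mappingCone.id_X φ 0 1 (by lia)
      have h0 : (mappingCone.fst φ).1.v 0 1 (by lia) = 0 := (hX _ (by lia)).eq_of_tgt _ _
      rw [h0, zero_comp, zero_add] at hid
      refine ⟨(mappingCone.snd φ).v 0 0 (add_zero _) ≫
        (singleXIso Y).hom ≫
        (HomologicalComplex.doubleXIso₁ θ rel_neg_one_zero neg_one_ne_zero_int).inv, ?_, ?_⟩
      · simp [doubleToMappingCone, φ]
      · simpa [doubleToMappingCone, φ] using hid
    have h₃ := HomologicalComplex.isZero_double_X θ rel_neg_one_zero i h₁ h₂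
    have h₄ := (mappingCone.isZero_X_iff φ i).2 ⟨hX _ (by lia), hY _ h₂⟩
    exact ⟨0, h₃.eq_of_src _ _, h₄.eq_of_src _ _⟩
  exact HomologicalComplex.Hom.isIso_of_components _

lemma exists_double_triangle :
    ∃ (a : (HomotopyCategory.singleFunctor C 0).obj Y ⟶
        (HomotopyCategory.quotient C (.up ℤ)).obj (HomologicalComplex.double θ rel_neg_one_zero))
      (b : (HomotopyCategory.quotient C (.up ℤ)).obj
          (HomologicalComplex.double θ rel_neg_one_zero) ⟶
        ((HomotopyCategory.singleFunctor C 0).obj X)⟦(1 : ℤ)⟧),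
      Triangle.mk ((HomotopyCategory.singleFunctor C 0).map θ) a b ∈ distTriang _ := by
  have hT := HomotopyCategory.mappingCone_triangleh_distinguished
    ((CochainComplex.singleFunctor C 0).map θ)
  let e := (HomotopyCategory.quotient C (.up ℤ)).mapIso (asIso (doubleToMappingCone θ))
  refine ⟨(mappingCone.triangleh ((CochainComplex.singleFunctor C 0).map θ)).mor₂ ≫ e.inv,
    e.hom ≫ (mappingCone.triangleh ((CochainComplex.singleFunctor C 0).map θ)).mor₃,
    isomorphic_distinguished _ hT _ (Triangle.isoMk _ _ (Iso.refl _) (Iso.refl _) e ?_ ?_ ?_)⟩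
  · exact (Category.comp_id _).trans (Category.id_comp _).symm
  · let m := (mappingCone.triangleh ((CochainComplex.singleFunctor C 0).map θ)).mor₂
    exact ((Category.assoc m e.inv e.hom).trans ((congrArg (m ≫ ·) e.inv_hom_id).trans
      (Category.comp_id m))).trans (Category.id_comp m).symm
  · refine Eq.trans ?_ (Category.comp_id (e.hom ≫ _))
    congr 1
    exact CategoryTheory.Functor.map_id _ _

end Double

/-! ### Projective modules as Gorenstein-projectives, and elements as morphisms from `A` -/

section

variable {A : Type u} [Ring A]

/-- Finitely generated projective modules are Gorenstein-projective. -/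
lemma gproj_of_projective (M : FGModuleCat.{u} A) (hM : Module.Projective A M) : gproj A M := by
  let P : FGModuleCat.{u} A := FGModuleCat.of A (M × M)
  -- The complete resolution is constant, equal to `M × M` with `d (x, y) = (0, x)`. The contraction
  -- `h (x, y) = (y, 0)` keeps it exact under every `Hom(-, Q)`.
  let d₀ : (M × M) →ₗ[A] (M × M) := LinearMap.inr A M M ∘ₗ LinearMap.fst A M M
  let h₀ : (M × M) →ₗ[A] (M × M) := LinearMap.inl A M M ∘ₗ LinearMap.snd A M M
  have hdd₀ : d₀ ∘ₗ d₀ = 0 := by ext x <;> simp [d₀]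
  have hdh₀ : h₀ ∘ₗ d₀ + d₀ ∘ₗ h₀ = LinearMap.id := by ext x <;> simp [d₀, h₀]
  have hex : Function.Exact d₀ d₀ := by
    rintro ⟨x, y⟩
    constructor
    · intro hx
      have hx : x = 0 := congrArg Prod.snd hx
      exact ⟨(y, 0), by simp [d₀, hx]⟩
    · rintro ⟨z, hz⟩
      rw [← hz, ← LinearMap.comp_apply, hdd₀, LinearMap.zero_apply]
  let e₀ : M →ₗ[A] LinearMap.ker d₀ :=
    (LinearMap.inr A M M).codRestrict (LinearMap.ker d₀) (fun c => by simp [d₀])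
  have he₀ : Function.Bijective e₀ := by
    constructor
    · intro x y hxy
      have := congrArg (fun z => z.1.2) hxy
      exact this
    · rintro ⟨⟨x, y⟩, hx⟩
      have hx : x = 0 := congrArg Prod.snd hx
      exact ⟨y, Subtype.ext (Prod.ext hx.symm rfl)⟩
  let d : P ⟶ P := FGModuleCat.ofHom d₀
  let h : P ⟶ P := FGModuleCat.ofHom h₀
  have hdd : d ≫ d = 0 := congrArg FGModuleCat.ofHom hdd₀
  have hdh : d ≫ h + h ≫ d = 𝟙 P := congrArg FGModuleCat.ofHom hdh₀
  let K : CochainComplex (FGModuleCat.{u} A) ℤ :=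
    CochainComplex.of (fun _ => P) (fun _ => d) (fun _ => hdd)
  have hK : ∀ n : ℤ, K.d n (n + 1) = d := fun n =>
    CochainComplex.of_d (fun _ : ℤ => P) (fun _ => d) n
  have hK' : ∀ n : ℤ, K.d (n - 1) n = d := fun n => by
    obtain ⟨m, rfl⟩ : ∃ m, n = m + 1 := ⟨n - 1, by lia⟩
    rw [show m + 1 - 1 = m by lia]
    exact hK m
  refine ⟨K, fun n => inferInstanceAs (Module.Projective A (M × M)), fun n => ?_, fun Q _ n => ?_, ?_⟩
  · rw [hK, hK']
    exact hex
  · intro f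
    simp only [hK, hK']
    constructor
    · intro hf
      refine ⟨h ≫ f, ?_⟩
      have := congrArg (· ≫ f) hdh
      change d ≫ f = 0 at hf
      change (d ≫ h + h ≫ d) ≫ f = 𝟙 P ≫ f at this
      rw [Preadditive.add_comp, Category.assoc, Category.assoc, hf, comp_zero, add_zero,
        Category.id_comp] at this
      exact this
    · rintro ⟨g, rfl⟩
      change d ≫ d ≫ g = 0
      rw [← Category.assoc, hdd, zero_comp]
  · rw [show K.d 0 1 = d from hK 0]
    exact ⟨LinearEquiv.ofBijective e₀ he₀⟩

variable (A) in
/-- The regular module. -/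
abbrev regular : FGModuleCat.{u} A := FGModuleCat.of A A

lemma gproj_regular : gproj A (regular A) := gproj_of_projective _ inferInstance

lemma gproj_of_isZero {M : FGModuleCat.{u} A} (hM : IsZero M) : gproj A M := by
  have : Subsingleton M := ⟨fun x y => by
    have h (z : M) : z = 0 := by
      have := congrArg (fun f : M ⟶ M => f.hom.hom z) (hM.eq_of_src (𝟙 M) 0)
      exact this
    rw [h x, h y]⟩
  exact gproj_of_projective _ inferInstance

/-- The morphism `A ⟶ M` given by an element of `M`. -/
def elementHom {M : FGModuleCat.{u} A} (x : M) : regular A ⟶ M :=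
  FGModuleCat.ofHom (LinearMap.toSpanSingleton A M x)

lemma elementHom_apply_one {M : FGModuleCat.{u} A} (x : M) : (elementHom x).hom.hom 1 = x :=
  one_smul A x

lemma regular_hom_ext {M : FGModuleCat.{u} A} {f g : regular A ⟶ M}
    (h : f.hom.hom (1 : A) = g.hom.hom (1 : A)) : f = g := by
  ext
  exact h

lemma elementHom_comp {M N : FGModuleCat.{u} A} (x : M) (f : M ⟶ N) :
    elementHom x ≫ f = elementHom (f.hom.hom x) :=
  regular_hom_ext (by
    change f.hom.hom ((elementHom x).hom.hom 1) = _
    rw [elementHom_apply_one, elementHom_apply_one])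

end

/-! ### Modules and Gorenstein-projective test objects in `D^b_gp(A)` -/

section

variable (A : Type u) [Ring A]

/-- The functor sending a module to the corresponding complex in degree zero, in `K^b(A)`. -/
def singleKb : FGModuleCat.{u} A ⥤ Kb A :=
  (bounded (FGModuleCat.{u} A)).lift (HomotopyCategory.singleFunctor (FGModuleCat.{u} A) 0)
    (fun _ => ⟨0, 0, fun _ _ => HomologicalComplex.isZero_single_obj_X _ _ _ _ (by lia)⟩)

instance : (singleKb A).Additive where
  map_add {X Y f g} := by
    apply (bounded (FGModuleCat.{u} A)).ι.map_injective
    exact (HomotopyCategory.singleFunctor (FGModuleCat.{u} A) 0).map_add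

/-- The functor sending a module to the corresponding complex in degree zero, in `D^b_gp(A)`. -/
def toDgp : FGModuleCat.{u} A ⥤ Dgp A := singleKb A ⋙ Qgp A

instance : (toDgp A).Additive := inferInstanceAs (singleKb A ⋙ Qgp A).Additive

variable {A}

/-- The complex `K` is exact in degree `n` after applying `Hom(G, -)`. -/
def HomExactAt (G : FGModuleCat.{u} A) (K : CochainComplex (FGModuleCat.{u} A) ℤ) (n : ℤ) : Prop :=
  ∀ x : G ⟶ K.X n, x ≫ K.d n (n + 1) = 0 → ∃ y : G ⟶ K.X (n - 1), y ≫ K.d (n - 1) n = x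

lemma homZero_singleKb_iff (G : FGModuleCat.{u} A) (K : Kb A) (n : ℤ) :
    HomZero ((singleKb A).obj G) K n ↔ HomExactAt G K.obj.as n := by
  rw [← HomZero.map_iff (bounded (FGModuleCat.{u} A)).ι
    ((bounded (FGModuleCat.{u} A)).fullyFaithfulι.map_bijective _ _)]
  exact homZero_single_left_iff G K.obj.as n

lemma gpAcyclic_iff (K : Kb A) :
    gpAcyclic A K ↔ ∀ G : FGModuleCat.{u} A, gproj A G → ∀ n, HomZero ((singleKb A).obj G) K n := by
  refine forall_congr' fun G => forall_congr' fun _ => ?_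
  refine (HomotopyCategory.quotient_obj_mem_subcategoryAcyclic_iff_exactAt
    (((preadditiveCoyoneda.obj (op G)).mapHomologicalComplex (.up ℤ)).obj K.obj.as)).trans ?_
  refine forall_congr' fun n => ?_
  rw [HomologicalComplex.exactAt_iff' _ (n - 1) n (n + 1) (by simp) (by simp),
    ShortComplex.ab_exact_iff, homZero_singleKb_iff]
  rfl

/-- Consequently, passing to the Verdier quotient does not change morphisms out of `G`. -/
lemma leftOrthogonal_singleKb {G : FGModuleCat.{u} A} (hG : gproj A G) :
    (gpAcyclic A).leftOrthogonal ((singleKb A).obj G) := fun K f hK =>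
  homZero_zero_iff.1 ((gpAcyclic_iff K).1 hK G hG 0) f

lemma homZero_ofModule_Qgp_iff {G : FGModuleCat.{u} A} (hG : gproj A G) (K : Kb A) (n : ℤ) :
    HomZero (ofModule G) ((Qgp A).obj K) n ↔ HomExactAt G K.obj.as n := by
  rw [← homZero_singleKb_iff]
  exact HomZero.map_iff (Qgp A) (ObjectProperty.leftOrthogonal.map_bijective_of_isTriangulated
    (leftOrthogonal_singleKb hG) (Qgp A) _)

lemma homZero_ofModule_ofModule {G : FGModuleCat.{u} A} (hG : gproj A G) (X : FGModuleCat.{u} A)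
    {n : ℤ} (hn : n ≠ 0) : HomZero (ofModule G) (ofModule X) n := by
  refine (homZero_ofModule_Qgp_iff hG ((singleKb A).obj X) n).2 ?_
  exact (homZero_single_left_iff G ((CochainComplex.singleFunctor _ 0).obj X) n).1
    (homZero_single_single G X hn)

lemma toDgp_map_bijective {G : FGModuleCat.{u} A} (hG : gproj A G) (X : FGModuleCat.{u} A) :
    Function.Bijective ((toDgp A).map : (G ⟶ X) → _) := by
  have h₁ : Function.Bijective ((singleKb A).map : (G ⟶ X) → _) := by
    refine ((bounded (FGModuleCat.{u} A)).fullyFaithfulι.map_bijective _ _).of_comp_iff' _ |>.1 ?_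
    exact singleFunctor_map_bijective G X
  exact (ObjectProperty.leftOrthogonal.map_bijective_of_isTriangulated
    (leftOrthogonal_singleKb hG) (Qgp A) _).comp h₁

lemma isZero_Qgp_obj {K : Kb A} (hK : gpAcyclic A K) : IsZero ((Qgp A).obj K) := by
  have h := Localization.inverts (Qgp A) (gpAcyclic A).trW _
    (ObjectProperty.trW.mk (gpAcyclic A) (contractible_distinguished₂ K)
      ((gpAcyclic A).le_shift (1 : ℤ) _ hK))
  exact ((Qgp A).map_isZero (isZero_zero (Kb A))).of_iso
    (@asIso _ _ _ _ ((Qgp A).map _) h)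

lemma exists_iso_Qgp_obj (Z : Dgp A) : ∃ K : Kb A, Nonempty ((Qgp A).obj K ≅ Z) := by
  have := Localization.essSurj (Qgp A) (gpAcyclic A).trW
  exact ⟨(Qgp A).objPreimage Z, ⟨(Qgp A).objObjPreimageIso Z⟩⟩

/-- Gorenstein-projectives detect zero objects: a complex representing `Z` is then one of those
killed by the quotient. -/
lemma isZero_of_homZero {Z : Dgp A}
    (h : ∀ G : FGModuleCat.{u} A, gproj A G → ∀ n, HomZero (ofModule G) Z n) : IsZero Z := by
  obtain ⟨K, ⟨e⟩⟩ := exists_iso_Qgp_obj Z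
  refine (isZero_Qgp_obj ((gpAcyclic_iff K).2 fun G hG n => ?_)).of_iso e.symm
  rw [homZero_singleKb_iff, ← homZero_ofModule_Qgp_iff hG]
  exact (h G hG n).of_iso_right e.symm

/-! ### The canonical truncation as a quotient complex -/

variable (K : CochainComplex (FGModuleCat.{u} A) ℤ)

/-- The subcomplex given by `K` in negative degrees and by the cycles in degree zero. -/
def truncSub (n : ℤ) : Submodule A (K.X n) :=
  -- An infimum over a false proposition is `⊤`, so each condition is imposed only in its range of
  -- degrees.
  (⨅ _ : 0 ≤ n, LinearMap.ker (K.d n (n + 1)).hom.hom) ⊓ ⨅ _ : 0 < n, ⊥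

variable {K} in
lemma mem_truncSub {n : ℤ} {x : K.X n} :
    x ∈ truncSub K n ↔ (0 ≤ n → (K.d n (n + 1)).hom.hom x = 0) ∧ (0 < n → x = 0) := by
  simp [truncSub, Submodule.mem_iInf]

lemma d_apply_d_apply {i j k : ℤ} (x : K.X i) :
    (K.d j k).hom.hom ((K.d i j).hom.hom x) = 0 :=
  congrArg (fun f : K.X i ⟶ K.X k => f.hom.hom x) (K.d_comp_d i j k)

lemma truncSub_le (i j : ℤ) : truncSub K i ≤ (truncSub K j).comap (K.d i j).hom.hom := by
  intro x hx
  rw [mem_truncSub] at hx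
  rw [Submodule.mem_comap, mem_truncSub]
  refine ⟨fun _ => d_apply_d_apply K x, fun hj => ?_⟩
  by_cases hij : i + 1 = j
  · subst hij
    exact hx.1 (by lia)
  · rw [K.shape i j hij]
    rfl

/-- The quotient of `K` by the subcomplex given by `K` in negative degrees and by the cycles in
degree zero. -/
def truncQuot : CochainComplex (FGModuleCat.{u} A) ℤ where
  X n := FGModuleCat.of A (K.X n ⧸ truncSub K n)
  d i j := FGModuleCat.ofHom (Submodule.mapQ _ _ (K.d i j).hom.hom (truncSub_le K i j))
  shape i j hij := by
    ext x
    change Submodule.Quotient.mk ((K.d i j).hom.hom x) = 0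
    rw [K.shape i j hij]
    rfl
  d_comp_d' i j k _ _ := by
    ext x
    change Submodule.Quotient.mk ((K.d j k).hom.hom ((K.d i j).hom.hom x)) = 0
    rw [d_apply_d_apply]
    rfl

/-- The projection to the truncation. -/
def truncπ : K ⟶ truncQuot K where
  f n := FGModuleCat.ofHom (truncSub K n).mkQ
  comm' _ _ _ := rfl

variable {K}

lemma truncπ_surjective {n : ℤ} (x : (truncQuot K).X n) :
    ∃ y : K.X n, ((truncπ K).f n).hom.hom y = x :=
  Submodule.mkQ_surjective _ x

lemma truncπ_eq_zero_iff {n : ℤ} (y : K.X n) :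
    ((truncπ K).f n).hom.hom y = 0 ↔ y ∈ truncSub K n :=
  Submodule.Quotient.mk_eq_zero _

lemma isZero_truncQuot_X {n : ℤ} (h : IsZero (K.X n)) : IsZero ((truncQuot K).X n) := by
  rw [IsZero.iff_id_eq_zero]
  ext x
  obtain ⟨w, rfl⟩ := truncπ_surjective x
  have : w = 0 := congrArg (fun f : K.X n ⟶ K.X n => f.hom.hom w) (h.eq_of_src (𝟙 _) 0)
  change ((truncπ K).f n).hom.hom w = 0
  rw [this, map_zero]

lemma trunc_d_truncπ {i j : ℤ} (y : K.X i) :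
    ((truncQuot K).d i j).hom.hom (((truncπ K).f i).hom.hom y) =
      ((truncπ K).f j).hom.hom ((K.d i j).hom.hom y) := rfl

lemma HomExactAt.truncQuot {G : FGModuleCat.{u} A} (hK : ∀ n, 0 ≤ n → HomExactAt G K n) (n : ℤ) :
    HomExactAt G (truncQuot K) n := by
  intro x hx
  by_cases hn : n ≤ 0
  -- In degrees `≤ 0` the differential of the quotient is injective, so the cycle `x` is zero. In
  -- positive degrees the projection is bijective and exactness is inherited from `K`.
  · refine ⟨0, ?_⟩
    rw [zero_comp]
    ext g
    obtain ⟨w, hw⟩ := truncπ_surjective (x.hom.hom g)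
    have h₁ : ((GorensteinSilting.truncQuot K).d n (n + 1)).hom.hom (x.hom.hom g) = 0 :=
      congrArg (fun f : G ⟶ (GorensteinSilting.truncQuot K).X (n + 1) => f.hom.hom g) hx
    rw [← hw, trunc_d_truncπ, truncπ_eq_zero_iff, mem_truncSub] at h₁
    change 0 = x.hom.hom g
    rw [← hw, eq_comm, truncπ_eq_zero_iff, mem_truncSub]
    exact ⟨fun h0 => h₁.2 (by lia), fun h0 => absurd h0 (by lia)⟩
  · have hinj : ∀ m, 0 < m → ∀ y : K.X m, ((truncπ K).f m).hom.hom y = 0 → y = 0 :=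
      fun m hm y hy => (mem_truncSub.1 ((truncπ_eq_zero_iff y).1 hy)).2 hm
    let e : K.X n ≃ₗ[A] (GorensteinSilting.truncQuot K).X n :=
      LinearEquiv.ofBijective ((truncπ K).f n).hom.hom
        ⟨(injective_iff_map_eq_zero _).2 (hinj n (by lia)), truncπ_surjective⟩
    let x' : G ⟶ K.X n := FGModuleCat.ofHom (e.symm.toLinearMap ∘ₗ x.hom.hom)
    have hx' : ∀ g, ((truncπ K).f n).hom.hom (x'.hom.hom g) = x.hom.hom g :=
      fun g => e.apply_symm_apply _
    obtain ⟨y, hy⟩ := hK n (by lia) x' (by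
      ext g
      refine hinj (n + 1) (by lia) _ ?_
      change ((truncπ K).f (n + 1)).hom.hom ((K.d n (n + 1)).hom.hom (x'.hom.hom g)) = 0
      rw [← trunc_d_truncπ, hx']
      exact congrArg (fun f : G ⟶ (GorensteinSilting.truncQuot K).X (n + 1) => f.hom.hom g) hx)
    refine ⟨y ≫ (truncπ K).f (n - 1), ?_⟩
    rw [Category.assoc, (truncπ K).comm, ← Category.assoc, hy]
    ext g
    exact hx' g

/-- A morphism to a complex in degree zero factors through the truncation of a complex which is
exact in degree zero. -/
lemma exists_truncπ_comp_eq {Y : FGModuleCat.{u} A}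
    (ψ : K ⟶ (CochainComplex.singleFunctor _ 0).obj Y) (hK : HomExactAt (regular A) K 0) :
    ∃ φ : truncQuot K ⟶ (CochainComplex.singleFunctor _ 0).obj Y, truncπ K ≫ φ = ψ := by
  let ψ₀ : K.X 0 ⟶ Y := ψ.f 0 ≫ (singleXIso Y).hom
  have hψ₀ : ∀ i : ℤ, K.d i 0 ≫ ψ₀ = 0 := fun i => by
    rw [← Category.assoc, ← ψ.comm, CochainComplex.singleFunctor_obj_d, comp_zero, zero_comp]
  -- Exactness tested on `A` makes every cycle in degree zero a boundary, and `ψ₀` kills boundaries.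
  have hle : truncSub K 0 ≤ LinearMap.ker ψ₀.hom.hom := by
    intro x hx
    have hx0 := (mem_truncSub.1 hx).1 le_rfl
    obtain ⟨y, hy⟩ := hK (elementHom x) (by
      rw [elementHom_comp, hx0]
      exact regular_hom_ext (by rw [elementHom_apply_one]; rfl))
    have h₁ : elementHom (ψ₀.hom.hom x) = 0 := by
      rw [← elementHom_comp, ← hy, Category.assoc, hψ₀, comp_zero]
    have h₂ := elementHom_apply_one (ψ₀.hom.hom x)
    rw [h₁] at h₂
    exact h₂.symm
  let φ₀ : (truncQuot K).X 0 ⟶ Y := FGModuleCat.ofHom ((truncSub K 0).liftQ ψ₀.hom.hom hle)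
  have hφ₀ : (truncπ K).f 0 ≫ φ₀ = ψ₀ := rfl
  refine ⟨HomologicalComplex.mkHomToSingle φ₀ fun i _ => ?_, ?_⟩
  · ext x
    obtain ⟨w, rfl⟩ := truncπ_surjective x
    change φ₀.hom.hom (((truncQuot K).d i 0).hom.hom (((truncπ K).f i).hom.hom w)) = 0
    rw [trunc_d_truncπ]
    exact congrArg (fun f : K.X i ⟶ Y => f.hom.hom w) (hψ₀ i)
  · refine HomologicalComplex.to_single_hom_ext ?_
    refine (congrArg ((truncπ K).f 0 ≫ ·) (HomologicalComplex.mkHomToSingle_f φ₀ _)).trans ?_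
    change ((truncπ K).f 0 ≫ φ₀) ≫ (singleXIso Y).inv = ψ.f 0
    rw [hφ₀, Category.assoc, Iso.hom_inv_id, Category.comp_id]

/-- If `Hom(G, Z[n]) = 0` for all Gorenstein-projective modules `G` and all `n ≥ 0`, then there is
no nonzero morphism from `Z` to a module. -/
lemma hom_ofModule_eq_zero {Z : Dgp A}
    (h : ∀ G : FGModuleCat.{u} A, gproj A G → ∀ n, 0 ≤ n → HomZero (ofModule G) Z n)
    {Y : FGModuleCat.{u} A} (f : Z ⟶ ofModule Y) : f = 0 := by
  obtain ⟨K, ⟨e⟩⟩ := exists_iso_Qgp_obj Z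
  rw [← cancel_epi e.hom, comp_zero]
  -- The source of the roof inherits the vanishing, so its numerator factors through a truncation
  -- that is zero in `D^b_gp(A)`.
  obtain ⟨φ, hφ⟩ := Localization.exists_rightFraction (Qgp A) (gpAcyclic A).trW
    (Y := (singleKb A).obj Y) (e.hom ≫ f)
  have : IsIso ((Qgp A).map φ.s) := Localization.inverts (Qgp A) (gpAcyclic A).trW _ φ.hs
  have hex : ∀ G : FGModuleCat.{u} A, gproj A G → ∀ n, 0 ≤ n → HomExactAt G φ.X'.obj.as n :=
    fun G hG n hn => (homZero_ofModule_Qgp_iff hG _ _).1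
      ((h G hG n hn).of_iso_right (asIso ((Qgp A).map φ.s) ≪≫ e).symm)
  obtain ⟨ψ, hψ⟩ := (HomotopyCategory.quotient _ _).map_surjective
    (X := φ.X'.obj.as) (Y := (CochainComplex.singleFunctor _ 0).obj Y) φ.f.hom
  obtain ⟨χ, rfl⟩ := exists_truncπ_comp_eq ψ (hex _ gproj_regular 0 le_rfl)
  let T : Kb A := ⟨(HomotopyCategory.quotient _ _).obj (truncQuot φ.X'.obj.as), by
    obtain ⟨a, b, hab⟩ := φ.X'.property
    exact ⟨a, b, fun i hi => isZero_truncQuot_X (hab i hi)⟩⟩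
  let p : φ.X' ⟶ T := ⟨(HomotopyCategory.quotient _ _).map (truncπ _)⟩
  let q : T ⟶ (singleKb A).obj Y := ⟨(HomotopyCategory.quotient _ _).map χ⟩
  have hpq : p ≫ q = φ.f := by
    ext
    exact ((HomotopyCategory.quotient _ _).map_comp _ _).symm.trans hψ
  have hT : IsZero ((Qgp A).obj T) := isZero_Qgp_obj ((gpAcyclic_iff T).2 fun G hG n => by
    rw [homZero_singleKb_iff]
    exact HomExactAt.truncQuot (hex G hG) n)
  refine hφ.trans
    (?_ : φ.map (Qgp A) _ = (0 : (Qgp A).obj K ⟶ (Qgp A).obj ((singleKb A).obj Y)))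
  rw [← cancel_epi ((Qgp A).map φ.s), MorphismProperty.RightFraction.map_s_comp_map, comp_zero, ← hpq,
    Functor.map_comp, hT.eq_of_tgt ((Qgp A).map p) 0, zero_comp]

end

/-! ### Vanishing on a cone in degrees `0` and `-1` -/

section

variable {C : Type*} [Category* C] [Preadditive C] [HasShift C ℤ]
  [∀ n : ℤ, (shiftFunctor C n).Additive] [HasZeroObject C] [Pretriangulated C]

lemma homZero_zero_of_surjective {T : Triangle C} (hT : T ∈ distTriang C) {P : C}
    (hs : ∀ g : P ⟶ T.obj₂, ∃ h : P ⟶ T.obj₁, h ≫ T.mor₁ = g) (h₁ : HomZero P T.obj₁ 1) :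
    HomZero P T.obj₃ 0 := by
  refine homZero_zero_iff.2 fun f => ?_
  obtain ⟨g, hg⟩ := Triangle.coyoneda_exact₃ _ hT f (h₁ _)
  obtain ⟨h, rfl⟩ := hs g
  rw [hg, Category.assoc, comp_distTriang_mor_zero₁₂ _ hT, comp_zero]

lemma homZero_neg_one_of_injective {T : Triangle C} (hT : T ∈ distTriang C) {P : C}
    (hi : ∀ k : P ⟶ T.obj₁, k ≫ T.mor₁ = 0 → k = 0) (h₂ : HomZero P T.obj₂ (-1)) :
    HomZero P T.obj₃ (-1) := by
  rw [← homZero_shift_left (a := 1) (n := 0) (by lia), homZero_zero_iff] at h₂ ⊢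
  intro f
  obtain ⟨k, hk⟩ := (shiftFunctor C (1 : ℤ)).map_surjective (f ≫ T.mor₃)
  have hk0 : k = 0 := hi k (by
    apply (shiftFunctor C (1 : ℤ)).map_injective
    rw [Functor.map_comp, hk, Category.assoc, comp_distTriang_mor_zero₃₁ _ hT, comp_zero,
      Functor.map_zero])
  obtain ⟨g, hg⟩ := Triangle.coyoneda_exact₃ _ hT f (by rw [← hk, hk0, Functor.map_zero])
  rw [hg, h₂ g, zero_comp]

end

/-! ### Triangles from two-term complexes and from `G`-exact sequences -/

section

variable {A : Type u} [Ring A] {G₁ G₀ : FGModuleCat.{u} A} (θ : G₁ ⟶ G₀)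

/-- The complex `G₁ ⟶ G₀` as an object of `K^b(A)`. -/
def twoTermKb : Kb A :=
  ⟨(HomotopyCategory.quotient _ _).obj (HomologicalComplex.double θ rel_neg_one_zero),
    -1, 0, fun i hi => HomologicalComplex.isZero_double_X θ rel_neg_one_zero i (by lia) (by lia)⟩

lemma exists_twoTermKb_triangle :
    ∃ (a : (singleKb A).obj G₀ ⟶ twoTermKb θ) (b : twoTermKb θ ⟶ ((singleKb A).obj G₁)⟦(1 : ℤ)⟧),
      Triangle.mk ((singleKb A).map θ) a b ∈ distTriang _ := by
  obtain ⟨a, b, hT⟩ := exists_double_triangle θ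
  let P := bounded (FGModuleCat.{u} A)
  let b' : twoTermKb θ ⟶ ((singleKb A).obj G₁)⟦(1 : ℤ)⟧ :=
    P.fullyFaithfulι.preimage (b ≫ (P.ι.commShiftIso (1 : ℤ)).inv.app ((singleKb A).obj G₁))
  let a' : (singleKb A).obj G₀ ⟶ twoTermKb θ := ⟨a⟩
  refine ⟨a', b', ?_⟩
  have hb' : P.ι.map b' ≫ (P.ι.commShiftIso (1 : ℤ)).hom.app ((singleKb A).obj G₁) = b := by
    rw [show P.ι.map b' = _ from P.fullyFaithfulι.map_preimage _]
    exact (Category.assoc _ _ _).trans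
      ((congrArg (b ≫ ·) ((P.ι.commShiftIso (1 : ℤ)).inv_hom_id_app _)).trans (Category.comp_id _))
  have : P.ι.mapTriangle.obj (Triangle.mk ((singleKb A).map θ) a' b') =
      Triangle.mk ((HomotopyCategory.singleFunctor _ 0).map θ) a b :=
    congrArg (Triangle.mk ((HomotopyCategory.singleFunctor _ 0).map θ) a) hb'
  change P.ι.mapTriangle.obj (Triangle.mk ((singleKb A).map θ) a' b') ∈ distTriang _
  rw [this]
  exact hT

lemma exists_twoTerm_triangle :
    ∃ (a : ofModule G₀ ⟶ twoTerm θ) (b : twoTerm θ ⟶ (ofModule G₁)⟦(1 : ℤ)⟧),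
      Triangle.mk ((toDgp A).map θ) a b ∈ distTriang _ := by
  obtain ⟨a, b, hT⟩ := exists_twoTermKb_triangle θ
  exact ⟨_, _, (Qgp A).map_distinguished _ hT⟩

variable {θ}

lemma leftOrthogonal_twoTermKb (h₁ : gproj A G₁) (h₀ : gproj A G₀) :
    (gpAcyclic A).leftOrthogonal (twoTermKb θ) := by
  obtain ⟨a, b, hT⟩ := exists_twoTermKb_triangle θ
  exact (gpAcyclic A).leftOrthogonal.ext_of_isTriangulatedClosed₃ _ hT
    (leftOrthogonal_singleKb h₁) (leftOrthogonal_singleKb h₀)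

/-- The triangle in `D^b_gp(A)` given by a `G`-exact sequence. -/
lemma IsGExact.exists_triangle {X Y Z : FGModuleCat.{u} A} {i : X ⟶ Y} {p : Y ⟶ Z}
    (h : IsGExact i p) :
    ∃ δ : ofModule Z ⟶ (ofModule X)⟦(1 : ℤ)⟧,
      Triangle.mk ((toDgp A).map i) ((toDgp A).map p) δ ∈ distTriang _ := by
  have hip : i ≫ p = 0 := by
    ext x
    exact (h.1.2.1 _).2 ⟨x, rfl⟩
  -- The cone `E` of `i` is compared with `Z` through `v`. Morphisms from Gorenstein-projectives
  -- show that the cone `V` of `v` is zero: only degrees `0` and `-1` need the `G`-exactness, which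
  -- gives surjectivity and injectivity of `v` on them.
  obtain ⟨E, b, c, hT⟩ := distinguished_cocone_triangle ((toDgp A).map i)
  obtain ⟨v, hv⟩ : ∃ v : E ⟶ (toDgp A).obj Z, (toDgp A).map p = b ≫ v :=
    Triangle.yoneda_exact₂ _ hT ((toDgp A).map p)
      (((toDgp A).map_comp i p).symm.trans (by rw [hip, Functor.map_zero]; rfl))
  obtain ⟨V, w, t, hV⟩ := distinguished_cocone_triangle v
  have hE : ∀ G : FGModuleCat.{u} A, gproj A G → ∀ n, n ≠ 0 → HomZero (ofModule G) E n := by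
    intro G hG n hn
    by_cases hn' : n = -1
    · subst hn'
      refine homZero_neg_one_of_injective hT (fun k hk => ?_)
        (homZero_ofModule_ofModule hG Y (by lia))
      obtain ⟨k, rfl⟩ := (toDgp_map_bijective hG X).2 k
      change (toDgp A).map k ≫ (toDgp A).map i = 0 at hk
      rw [← Functor.map_comp, ← (toDgp A).map_zero] at hk
      have hk' := (toDgp_map_bijective hG Y).1 hk
      rw [(h.2 G hG).1 (a₁ := k) (a₂ := 0) (by simpa using hk'), Functor.map_zero]
      rfl
    · exact HomZero.of_dist₃ hT (m := n + 1) (by lia) (homZero_ofModule_ofModule hG Y hn)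
        (homZero_ofModule_ofModule hG X (by lia))
  have hVz : IsZero V := by
    refine isZero_of_homZero fun G hG n => ?_
    by_cases h0 : n = 0
    · subst h0
      refine homZero_zero_of_surjective hV (fun g => ?_) (hE G hG 1 (by lia))
      obtain ⟨g, rfl⟩ := (toDgp_map_bijective hG Z).2 g
      obtain ⟨g', hg'⟩ := (h.2 G hG).2.2 g
      change g' ≫ p = g at hg'
      refine ⟨(toDgp A).map g' ≫ b, ?_⟩
      rw [← hg', Functor.map_comp, hv]
      exact Category.assoc _ _ _
    by_cases h1 : n = -1
    · subst h1
      refine homZero_neg_one_of_injective hV (fun (k : (toDgp A).obj G ⟶ E) hk => ?_)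
        (homZero_ofModule_ofModule hG Z (by lia))
      obtain ⟨l, hl⟩ := Triangle.coyoneda_exact₃ _ hT k
        (homZero_ofModule_ofModule hG X one_ne_zero _)
      obtain ⟨l, rfl⟩ := (toDgp_map_bijective hG Y).2 l
      change k = (toDgp A).map l ≫ b at hl
      change k ≫ v = 0 at hk
      rw [hl, Category.assoc, ← hv, ← Functor.map_comp, ← (toDgp A).map_zero] at hk
      have hk' := (toDgp_map_bijective hG Z).1 hk
      obtain ⟨l', hl'⟩ := ((h.2 G hG).2.1 l).1 hk'
      change l' ≫ i = l at hl'
      rw [hl, ← hl', Functor.map_comp, Category.assoc]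
      exact (congrArg ((toDgp A).map l' ≫ ·) (comp_distTriang_mor_zero₁₂ _ hT)).trans comp_zero
    · exact HomZero.of_dist₃ hV (m := n + 1) (by lia) (homZero_ofModule_ofModule hG Z h0)
        (hE G hG _ (by lia))
  have : IsIso v := (Triangle.isZero₃_iff_isIso₁ _ hV).1 hVz
  let e : E ≅ (toDgp A).obj Z := asIso v
  refine ⟨e.inv ≫ c, isomorphic_distinguished _ hT _
    (Triangle.isoMk _ _ (Iso.refl _) (Iso.refl _) e.symm ?_ ?_ ?_)⟩
  · exact (Category.comp_id _).trans (Category.id_comp _).symm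
  · change (toDgp A).map p ≫ e.inv = 𝟙 _ ≫ b
    rw [hv, Category.assoc, show v ≫ e.inv = 𝟙 E from e.hom_inv_id, Category.comp_id, Category.id_comp]
  · change (e.inv ≫ c) ≫ (𝟙 ((toDgp A).obj X))⟦(1 : ℤ)⟧' = e.inv ≫ c
    rw [CategoryTheory.Functor.map_id, Category.comp_id]

end

/-! ### Finite generation of morphisms from a two-term complex -/

section Finiteness

variable (k : Type*) [Field k] {A : Type u} [Ring A] [Algebra k A]

open scoped ModuleCat in
lemma finite_hom [Module.Finite k A] (M N : FGModuleCat.{u} A) : Module.Finite k (M ⟶ N) := by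
  have hM : Module.Finite k M.obj := Module.Finite.trans A _
  have hN : Module.Finite k N.obj := Module.Finite.trans A _
  let e : (M ⟶ N) →ₗ[k] (M.obj →ₗ[k] N.obj) :=
    { toFun f := f.hom.hom.restrictScalars k
      map_add' _ _ := rfl
      map_smul' _ _ := rfl }
  refine Module.Finite.of_injective e fun f g hfg => ?_
  ext x
  exact congrArg (fun l : M.obj →ₗ[k] N.obj => l x) hfg

/-- The morphisms from a two-term complex form a finitely generated module over endomorphisms. -/
lemma exists_finite_family [Module.Finite k A] {G₁ G₀ : FGModuleCat.{u} A} {θ : G₁ ⟶ G₀}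
    (h₁ : gproj A G₁) (h₀ : gproj A G₀) (Z : Dgp A) :
    ∃ (n : ℕ) (f : Fin n → (twoTerm θ ⟶ Z)), ∀ g : twoTerm θ ⟶ Z,
      ∃ e : Fin n → (twoTerm θ ⟶ twoTerm θ), g = ∑ j, e j ≫ f j := by
  obtain ⟨K, ⟨iso⟩⟩ := exists_iso_Qgp_obj Z
  let E : Dgp A := (Qgp A).obj (twoTermKb θ)
  change ∃ (n : ℕ) (f : Fin n → (E ⟶ Z)), ∀ g : E ⟶ Z, ∃ e : Fin n → (E ⟶ E), g = ∑ j, e j ≫ f j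
  let W : CochainComplex (FGModuleCat.{u} A) ℤ := HomologicalComplex.double θ rel_neg_one_zero
  let L : CochainComplex (FGModuleCat.{u} A) ℤ := K.obj.as
  have : Module.Finite k (W ⟶ L) := by
    have := finite_hom k (W.X (-1)) (L.X (-1))
    have := finite_hom k (W.X 0) (L.X 0)
    let e : (W ⟶ L) →ₗ[k] (W.X (-1) ⟶ L.X (-1)) × (W.X 0 ⟶ L.X 0) :=
      { toFun f := (f.f (-1), f.f 0)
        map_add' _ _ := rfl
        map_smul' _ _ := rfl }
    refine Module.Finite.of_injective e fun f g hfg => ?_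
    exact HomologicalComplex.from_double_hom_ext (congrArg Prod.fst hfg) (congrArg Prod.snd hfg)
  obtain ⟨n, s, hs⟩ := Module.Finite.exists_fin (R := k) (M := (W ⟶ L))
  let F₁ (φ : W ⟶ W) : E ⟶ E :=
    (Qgp A).map (X := twoTermKb θ) (Y := twoTermKb θ) ⟨(HomotopyCategory.quotient _ _).map φ⟩
  let F₂ (φ : W ⟶ L) : E ⟶ (Qgp A).obj K :=
    (Qgp A).map (X := twoTermKb θ) ⟨(HomotopyCategory.quotient _ _).map φ⟩
  have F_comp (φ : W ⟶ W) (ψ : W ⟶ L) : F₂ (φ ≫ ψ) = F₁ φ ≫ F₂ ψ := by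
    refine Eq.trans ?_ ((Qgp A).map_comp _ _)
    refine congrArg (Qgp A).map ?_
    ext
    exact (HomotopyCategory.quotient _ _).map_comp _ _
  let F₂' : (W ⟶ L) →+ (E ⟶ (Qgp A).obj K) :=
    AddMonoidHom.mk' F₂ fun φ ψ => by
      refine Eq.trans ?_ ((Qgp A).map_add)
      refine congrArg (Qgp A).map ?_
      ext
      exact (HomotopyCategory.quotient _ _).map_add
  refine ⟨n, fun j => F₂ (s j) ≫ iso.hom, fun g => ?_⟩
  -- By left orthogonality every morphism comes from an actual chain map, and chain maps form a
  -- finite-dimensional space.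
  obtain ⟨g', hg'⟩ := (ObjectProperty.leftOrthogonal.map_bijective_of_isTriangulated
    (leftOrthogonal_twoTermKb (θ := θ) h₁ h₀) (Qgp A) K).2 (g ≫ iso.inv)
  obtain ⟨φ, hφ⟩ := (HomotopyCategory.quotient _ _).map_surjective (X := W) (Y := L) g'.hom
  have hφg : F₂ φ = g ≫ iso.inv := by
    rw [← hg']
    refine congrArg (Qgp A).map ?_
    ext
    exact hφ
  obtain ⟨c, hc⟩ := (Submodule.mem_span_range_iff_exists_fun k).1
    (hs.symm ▸ Submodule.mem_top : φ ∈ Submodule.span k (Set.range s))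
  -- Scalars are absorbed into endomorphisms, so no `k`-linear structure on `D^b_gp(A)` is needed.
  refine ⟨fun j => F₁ (c j • 𝟙 W), ?_⟩
  have hsum : F₂ φ = ∑ j, F₁ (c j • 𝟙 W) ≫ F₂ (s j) := by
    rw [← hc]
    refine (map_sum F₂' _ _).trans (Finset.sum_congr rfl fun j _ => ?_)
    rw [← F_comp]
    have : (c j • 𝟙 W) ≫ s j = c j • s j :=
      (Linear.smul_comp W W L (c j) (𝟙 W) (s j)).trans (by rw [Category.id_comp])
    exact congrArg F₂ this.symm
  rw [← cancel_mono iso.inv, ← hφg, hsum, Preadditive.sum_comp]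
  refine Finset.sum_congr rfl fun j _ => ?_
  rw [Category.assoc, Category.assoc, iso.hom_inv_id, Category.comp_id]

end Finiteness

/-! ### Approximations by an object without positive self-extensions -/

section

variable {C : Type*} [Category* C] [Preadditive C] [HasShift C ℤ]
  [∀ n : ℤ, (shiftFunctor C n).Additive] [HasZeroObject C] [Pretriangulated C]

/-- `Hom(G, X[i]) = 0` for all `i > 0`. -/
def PosOrthogonal (G X : C) : Prop := ∀ i : ℤ, 1 ≤ i → HomZero G X i

/-- The objects `Z` such that `Hom(Z, X[i])` vanishes for large `i`, uniformly in all `X` such that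
`Hom(G, X[i]) = 0` for all `i > 0`. -/
def eventuallyOrthogonal (G : C) : ObjectProperty C := fun Z =>
  ∃ N : ℤ, ∀ X : C, PosOrthogonal G X → ∀ i, N ≤ i → HomZero Z X i

instance (G : C) : (eventuallyOrthogonal G).IsStableUnderRetracts where
  of_retract e := fun ⟨N, hN⟩ => ⟨N, fun X hX i hi => (hN X hX i hi).of_retract_left e⟩

/-- Since the bound does not depend on `X`, shifts translate it and extensions take the maximum of
two bounds. -/
instance (G : C) : (eventuallyOrthogonal G).IsTriangulated where
  exists_zero := ⟨0, isZero_zero _, 0, fun _ _ _ _ _ => (isZero_zero C).eq_of_src _ _⟩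
  isStableUnderShiftBy a :=
    { le_shift := fun Z ⟨N, hN⟩ => ⟨N + a, fun X hX i hi =>
        (homZero_shift_left (m := i - a) (by lia)).2 (hN X hX _ (by lia))⟩ }
  toIsTriangulatedClosed₂ := .mk' fun _ hT ⟨N₁, h₁⟩ ⟨N₃, h₃⟩ =>
    ⟨max N₁ N₃, fun X hX i hi => HomZero.dist₂ hT (h₁ X hX i (by lia)) (h₃ X hX i (by lia))⟩

/-- The morphisms `G ⟶ X` are generated by a finite family under precomposition. -/
def IsGenerating {G X : C} {n : ℕ} (f : Fin n → (G ⟶ X)) : Prop :=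
  ∀ g : G ⟶ X, ∃ e : Fin n → (G ⟶ G), g = ∑ j, e j ≫ f j

lemma exists_approximation_triangle {G X : C} (hG : PosOrthogonal G G) (hX : PosOrthogonal G X)
    {n : ℕ} {f : Fin n → (G ⟶ X)} (hf : IsGenerating f) [HasBiproduct fun _ : Fin n => G] :
    ∃ (X' : C) (a : X' ⟶ ⨁ fun _ : Fin n => G) (c : X ⟶ X'⟦(1 : ℤ)⟧),
      Triangle.mk a (biproduct.desc f) c ∈ distTriang C ∧ PosOrthogonal G X' := by
  obtain ⟨X', a, c, hT⟩ := distinguished_cocone_triangle₁ (biproduct.desc f)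
  refine ⟨X', a, c, hT, fun i hi => ?_⟩
  have hB : ∀ i : ℤ, 1 ≤ i → HomZero G (⨁ fun _ : Fin n => G) i :=
    fun i hi => HomZero.biproduct fun _ => hG i hi
  -- Degree one is where generation enters: `Hom(G, X)` need not vanish, but it is hit by `Hom(G,
  -- Gⁿ)`.
  by_cases h1 : i = 1
  · subst h1
    refine (homZero_shift_right (add_zero _)).1
      (homZero_zero_of_surjective (rot_of_distTriang _ hT) (fun g => ?_) (hB 1 le_rfl))
    obtain ⟨e, he⟩ := hf g
    refine ⟨biproduct.lift e, ?_⟩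
    exact biproduct.lift_desc.trans he.symm
  · exact HomZero.of_dist₁ hT (n := i - 1) (by lia) (hB i hi) (hX _ (by lia))

/-- If `P` lies in the thick subcategory generated by `G` and there are no morphisms of positive
degree from `P` to `G`, then there are none of degree one to the objects `X` with
`Hom(G, X[i]) = 0` for `i > 0`. -/
lemma homZero_one_of_triangEnvelope {G P : C} (hG : PosOrthogonal G G) (hP : PosOrthogonal P G)
    (hfin : ∀ Z : C, ∃ (n : ℕ) (f : Fin n → (G ⟶ Z)), IsGenerating f)
    (hGP : (ObjectProperty.singleton G).triangEnvelope P) {X : C} (hX : PosOrthogonal G X) :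
    HomZero P X 1 := by
  have := HasFiniteBiproducts.of_hasFiniteProducts (C := C)
  have hle : (ObjectProperty.singleton G).triangEnvelope ≤ eventuallyOrthogonal G := by
    rw [ObjectProperty.triangEnvelope_le_iff, ObjectProperty.singleton_le_iff]
    exact ⟨1, fun X hX i hi => hX i hi⟩
  obtain ⟨N, hN⟩ := hle _ hGP
  -- Here `m` bounds the distance from `j` up to the vanishing range. Each approximation embeds
  -- `Hom(P, X[j])` in `Hom(P, X'[j + 1])`, so `X` must vary in the induction and the bound `N` must
  -- be uniform in it.
  suffices ∀ (m : ℕ) (X : C), PosOrthogonal G X → ∀ j : ℤ, 1 ≤ j → N ≤ j + m → HomZero P X j from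
    this (N - 1).toNat X hX 1 le_rfl (by lia)
  intro m
  induction m with
  | zero => exact fun X hX j _ hj => hN X hX j (by simpa using hj)
  | succ m ih =>
    intro X hX j hj hm
    obtain ⟨n, f, hf⟩ := hfin X
    obtain ⟨X', a, c, hT, hX'⟩ := exists_approximation_triangle hG hX hf
    exact HomZero.of_dist₃ hT (m := 1 + j) rfl (HomZero.biproduct fun _ => hP j hj)
      (ih X' hX' (1 + j) (by lia) (by push_cast at hm; lia))

lemma IsGenerating.exists_eq_sum {G P : C} (hG : PosOrthogonal G G) (hP : PosOrthogonal P G)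
    (hfin : ∀ Z : C, ∃ (n : ℕ) (f : Fin n → (G ⟶ Z)), IsGenerating f)
    (hGP : (ObjectProperty.singleton G).triangEnvelope P) {X : C} (hX : PosOrthogonal G X)
    {n : ℕ} {f : Fin n → (G ⟶ X)} (hf : IsGenerating f) (g : P ⟶ X) :
    ∃ e : Fin n → (P ⟶ G), g = ∑ j, e j ≫ f j := by
  have := HasFiniteBiproducts.of_hasFiniteProducts (C := C)
  obtain ⟨X', a, c, hT, hX'⟩ := exists_approximation_triangle hG hX hf
  obtain ⟨h, hh⟩ : ∃ h : P ⟶ ⨁ fun _ : Fin n => G, g = h ≫ biproduct.desc f :=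
    Triangle.coyoneda_exact₃ _ hT g (homZero_one_of_triangEnvelope hG hP hfin hGP hX' _)
  refine ⟨fun j => h ≫ biproduct.π _ j, ?_⟩
  rw [hh, biproduct.desc_eq, Preadditive.comp_sum]
  simp only [Category.assoc]

end

/-! ### Finite direct sums and their images in `D^b_gp(A)` -/

section

variable {C : Type*} [Category* C] [Preadditive C] [HasShift C ℤ]

lemma HomZero.of_sum_left {J : Type*} [Fintype J] {S T Y : C} (π : J → (T ⟶ S)) (ι : J → (S ⟶ T))
    (h : ∑ j, π j ≫ ι j = 𝟙 T) {n : ℤ} (hS : HomZero S Y n) : HomZero T Y n := fun f => by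
  rw [← Category.id_comp f, ← h, Preadditive.sum_comp]
  refine Finset.sum_eq_zero fun j _ => ?_
  rw [Category.assoc, hS (ι j ≫ f), comp_zero]

lemma HomZero.of_sum_right [∀ n : ℤ, (shiftFunctor C n).Additive] {J : Type*} [Fintype J]
    {S T Y : C} (π : J → (T ⟶ S)) (ι : J → (S ⟶ T)) (h : ∑ j, π j ≫ ι j = 𝟙 T) {n : ℤ}
    (hS : HomZero Y S n) : HomZero Y T n := fun f => by
  have h1 : ∑ j, (π j)⟦n⟧' ≫ (ι j)⟦n⟧' = 𝟙 (T⟦n⟧) := by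
    simp only [← Functor.map_comp, ← Functor.map_sum, h, CategoryTheory.Functor.map_id]
  rw [← Category.comp_id f, ← h1, Preadditive.comp_sum]
  refine Finset.sum_eq_zero fun j _ => ?_
  rw [← Category.assoc, hS (f ≫ (π j)⟦n⟧'), zero_comp]

end

variable {A : Type u} [Ring A]

instance : (gproj A).IsClosedUnderIsomorphisms where
  of_iso e := fun ⟨P, h₁, h₂, h₃, ⟨f⟩⟩ =>
    ⟨P, h₁, h₂, h₃, ⟨(FGModuleCat.isoToLinearEquiv e.symm).trans f⟩⟩

lemma kbGproj_ofModule {G : FGModuleCat.{u} A} (hG : gproj A G) : kbGproj (ofModule G) := by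
  refine ⟨(singleKb A).obj G, fun i => ?_, ⟨Iso.refl _⟩⟩
  by_cases hi : i = 0
  · subst hi
    exact (gproj A).prop_of_iso (singleXIso G).symm hG
  · exact gproj_of_isZero (HomologicalComplex.isZero_single_obj_X _ _ _ _ hi)

section Sums

variable (n : ℕ) (M : FGModuleCat.{u} A)

/-- The direct sum of `n` copies of a module. -/
abbrev power : FGModuleCat.{u} A := FGModuleCat.of A (Fin n → M)

variable {n M}

/-- The projections from a direct sum of copies of a module. -/
def powerπ (j : Fin n) : power n M ⟶ M :=
  FGModuleCat.ofHom (LinearMap.proj j : (Fin n → M) →ₗ[A] M)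

/-- The inclusions to a direct sum of copies of a module. -/
def powerι (j : Fin n) : M ⟶ power n M :=
  FGModuleCat.ofHom (LinearMap.single A (fun _ : Fin n => (M : Type u)) j)

lemma powerι_powerπ_self (j : Fin n) : (powerι j : M ⟶ _) ≫ powerπ j = 𝟙 M := by
  ext x
  exact Pi.single_eq_same (M := fun _ : Fin n => (M : Type u)) j x

lemma powerι_powerπ_of_ne {i j : Fin n} (h : i ≠ j) : (powerι i : M ⟶ _) ≫ powerπ j = 0 := by
  ext x
  exact Pi.single_eq_of_ne (M := fun _ : Fin n => (M : Type u)) h.symm x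

/-- Evaluation of morphisms of modules. -/
def evalHom {X Y : FGModuleCat.{u} A} (x : X) : (X ⟶ Y) →+ Y where
  toFun f := f.hom.hom x
  map_zero' := rfl
  map_add' _ _ := rfl

lemma sum_powerπ_powerι : ∑ j, (powerπ j ≫ powerι j : power n M ⟶ _) = 𝟙 _ := by
  refine InducedCategory.hom_ext (ModuleCat.hom_ext (LinearMap.ext fun x : Fin n → M => ?_))
  refine (map_sum (evalHom (X := power n M) (Y := power n M) x) _ _).trans ?_
  exact Finset.univ_sum_single x

/-- The morphism from a direct sum given by a family of morphisms. -/
def powerDesc {X : FGModuleCat.{u} A} (g : Fin n → (M ⟶ X)) : power n M ⟶ X :=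
  ∑ j, powerπ j ≫ g j

lemma powerι_desc {X : FGModuleCat.{u} A} (g : Fin n → (M ⟶ X)) (j : Fin n) :
    powerι j ≫ powerDesc g = g j := by
  rw [powerDesc, Preadditive.comp_sum, Finset.sum_eq_single j]
  · rw [← Category.assoc, powerι_powerπ_self, Category.id_comp]
  · intro i _ hi
    rw [← Category.assoc, powerι_powerπ_of_ne hi.symm, zero_comp]
  · simp

lemma addClosure_power : addClosure M (power n M) := ⟨n, ⟨Retract.refl _⟩⟩

lemma HomZero.toDgp_power_left {Y : Dgp A} {i : ℤ} (h : HomZero (ofModule M) Y i) :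
    HomZero (ofModule (power n M)) Y i :=
  HomZero.of_sum_left (fun j : Fin n => (toDgp A).map (powerπ j)) (fun j => (toDgp A).map (powerι j))
    (by simp only [← Functor.map_comp, ← Functor.map_sum, sum_powerπ_powerι]
        exact (toDgp A).map_id _) h

lemma HomZero.toDgp_power_right {Y : Dgp A} {i : ℤ} (h : HomZero Y (ofModule M) i) :
    HomZero Y (ofModule (power n M)) i :=
  HomZero.of_sum_right (fun j : Fin n => (toDgp A).map (powerπ j))
    (fun j => (toDgp A).map (powerι j))
    (by simp only [← Functor.map_comp, ← Functor.map_sum, sum_powerπ_powerι]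
        exact (toDgp A).map_id _) h

end Sums

/-! ### Two-term complexes and their `H⁰` -/

section TwoTerm

variable {G₁ G₀ : FGModuleCat.{u} A} {θ : G₁ ⟶ G₀}

lemma homZero_ofModule_twoTerm {G : FGModuleCat.{u} A} (hG : gproj A G) {n : ℤ} (h₀ : n ≠ 0)
    (h₁ : n ≠ -1) : HomZero (ofModule G) (twoTerm θ) n := by
  obtain ⟨a, b, hT⟩ := exists_twoTerm_triangle θ
  exact HomZero.of_dist₃ hT (m := 1 + n) rfl (homZero_ofModule_ofModule hG G₀ h₀)
    (homZero_ofModule_ofModule hG G₁ (by lia))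

lemma homZero_twoTerm {Y : Dgp A} {n m : ℤ} (hm : 1 + n = m) (h₁ : HomZero (ofModule G₁) Y n)
    (h₀ : HomZero (ofModule G₀) Y m) : HomZero (twoTerm θ) Y m := by
  obtain ⟨a, b, hT⟩ := exists_twoTerm_triangle θ
  exact HomZero.dist₃ hT hm h₁ h₀

namespace IsPartialGorensteinSilting

variable (hθ : IsPartialGorensteinSilting θ)

include hθ

/-- Degrees at least two vanish because the complex has only two terms; the presilting condition
supplies degree one. -/
lemma posOrthogonal_self : PosOrthogonal (twoTerm θ) (twoTerm θ) := by
  intro i hi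
  by_cases h1 : i = 1
  · subst h1
    exact hθ.hom_shift_eq_zero
  · exact homZero_twoTerm (n := i - 1) (by lia)
      (homZero_ofModule_twoTerm hθ.gproj₁ (by lia) (by lia))
      (homZero_ofModule_twoTerm hθ.gproj₀ (by lia) (by lia))

lemma posOrthogonal_ofModule {X : FGModuleCat.{u} A} (hX : torsionClass θ X) :
    PosOrthogonal (twoTerm θ) (ofModule X) := by
  intro i hi
  by_cases h1 : i = 1
  · subst h1
    exact hX
  · exact homZero_twoTerm (n := i - 1) (by lia)
      (homZero_ofModule_ofModule hθ.gproj₁ X (by lia))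
      (homZero_ofModule_ofModule hθ.gproj₀ X (by lia))

/-- A morphism from a Gorenstein-projective module to `G₀` which vanishes in `H⁰` factors
through `θ`. -/
lemma exists_comp_eq {G : FGModuleCat.{u} A} (hG : gproj A G) (l : G ⟶ G₀)
    (hl : l ≫ toH0 θ = 0) : ∃ h : G ⟶ G₁, h ≫ θ = l := by
  have hl' : ∀ x, l.hom.hom x ∈ LinearMap.range θ.hom.hom := fun x =>
    (Submodule.Quotient.mk_eq_zero _).1 (congrArg (fun f : G ⟶ H0 θ => f.hom.hom x) hl)
  obtain ⟨h, hh⟩ := hθ.approx₁.2 G hG (FGModuleCat.ofHom (l.hom.hom.codRestrict _ hl'))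
  refine ⟨h, ?_⟩
  ext x
  exact congrArg Subtype.val (congrArg (fun f : G ⟶
    FGModuleCat.of A (LinearMap.range θ.hom.hom) => f.hom.hom x) hh)

/-- There is a morphism from a two-term complex to its `H⁰` whose cone has no nonzero morphisms of
degree `≥ -1` from Gorenstein-projective modules. -/
lemma exists_toH0_triangle :
    ∃ (a : ofModule G₀ ⟶ twoTerm θ) (b : twoTerm θ ⟶ (ofModule G₁)⟦(1 : ℤ)⟧)
      (α : twoTerm θ ⟶ ofModule (H0 θ)) (Z : Dgp A) (β : ofModule (H0 θ) ⟶ Z)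
      (γ : Z ⟶ (twoTerm θ)⟦(1 : ℤ)⟧),
      Triangle.mk ((toDgp A).map θ) a b ∈ distTriang _ ∧ a ≫ α = (toDgp A).map (toH0 θ) ∧
      Triangle.mk α β γ ∈ distTriang _ ∧
      ∀ G : FGModuleCat.{u} A, gproj A G → ∀ n, -1 ≤ n → HomZero (ofModule G) Z n := by
  obtain ⟨a, b, hT⟩ := exists_twoTerm_triangle θ
  have hπ : θ ≫ toH0 θ = 0 := by
    ext x
    exact (Submodule.Quotient.mk_eq_zero _).2 ⟨x, rfl⟩
  obtain ⟨α, hα⟩ : ∃ α : twoTerm θ ⟶ ofModule (H0 θ), (toDgp A).map (toH0 θ) = a ≫ α :=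
    Triangle.yoneda_exact₂ _ hT ((toDgp A).map (toH0 θ))
      (((toDgp A).map_comp _ _).symm.trans (by rw [hπ, Functor.map_zero]; rfl))
  obtain ⟨Z, β, γ, hZ⟩ := distinguished_cocone_triangle α
  refine ⟨a, b, α, Z, β, γ, hT, hα.symm, hZ, fun G hG n hn => ?_⟩
  -- Degree `0` uses the approximation of the cokernel (surjectivity onto `Hom(G, H⁰)`), and degree
  -- `-1` that of the image (injectivity of `Hom(G, G•) ⟶ Hom(G, H⁰)`).
  by_cases h0 : n = 0
  · subst h0
    refine homZero_zero_of_surjective hZ (fun g => ?_)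
      (homZero_ofModule_twoTerm hG (by lia) (by lia))
    obtain ⟨g, rfl⟩ := (toDgp_map_bijective hG (H0 θ)).2 g
    obtain ⟨h, rfl⟩ := hθ.approx₀.2 G hG g
    refine ⟨(toDgp A).map h ≫ a, ?_⟩
    rw [Functor.map_comp, hα]
    exact Category.assoc _ _ _
  by_cases h1 : n = -1
  · subst h1
    refine homZero_neg_one_of_injective hZ (fun (k : ofModule G ⟶ twoTerm θ) hk => ?_)
      (homZero_ofModule_ofModule hG (H0 θ) (by lia))
    obtain ⟨l, hl⟩ : ∃ l : ofModule G ⟶ ofModule G₀, k = l ≫ a :=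
      Triangle.coyoneda_exact₃ _ hT k (homZero_ofModule_ofModule hG G₁ one_ne_zero _)
    obtain ⟨l, rfl⟩ := (toDgp_map_bijective hG G₀).2 l
    have hk' : (toDgp A).map l ≫ (toDgp A).map (toH0 θ) = 0 :=
      (congrArg ((toDgp A).map l ≫ ·) hα).trans
        ((Category.assoc _ _ _).symm.trans ((congrArg (· ≫ α) hl.symm).trans hk))
    obtain ⟨h, rfl⟩ := hθ.exists_comp_eq hG l ((toDgp_map_bijective hG (H0 θ)).1
      ((((toDgp A).map_comp _ _).trans hk').trans ((toDgp A).map_zero _ _).symm))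
    rw [hl, Functor.map_comp]
    refine (Category.assoc _ _ _).trans ?_
    exact (congrArg ((toDgp A).map h ≫ ·) (comp_distTriang_mor_zero₁₂ _ hT)).trans comp_zero
  · exact HomZero.of_dist₃ hZ (m := n + 1) (by lia) (homZero_ofModule_ofModule hG (H0 θ) h0)
      (homZero_ofModule_twoTerm hG (by lia) (by lia))

lemma torsionClass_H0 : torsionClass θ (H0 θ) := by
  obtain ⟨a, b, α, Z, β, γ, hT, hα, hZ, h⟩ := hθ.exists_toH0_triangle
  exact HomZero.of_dist₂ hZ hθ.hom_shift_eq_zero (homZero_twoTerm (n := 0) (by lia)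
    (h G₁ hθ.gproj₁ 0 (by lia)) (h G₀ hθ.gproj₀ 1 (by lia)))

/-- `Hom(H⁰, Y[1])` lies between `Hom(Z, Y[1])` and `Hom(G•, Y[1])`. The former is `Hom(Z[-1], Y)`,
and the bound `n ≥ -1` for `Z` is exactly what the truncation argument requires of `Z[-1]`. -/
lemma homZero_H0 {Y : FGModuleCat.{u} A} (hY : torsionClass θ Y) :
    HomZero (ofModule (H0 θ)) (ofModule Y) 1 := by
  obtain ⟨a, b, α, Z, β, γ, hT, hα, hZ, h⟩ := hθ.exists_toH0_triangle
  refine HomZero.dist₂ hZ hY ((homZero_shift_left (a := -1) (n := 0) (by lia)).1 ?_)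
  refine homZero_zero_iff.2 fun f => hom_ofModule_eq_zero (fun G hG n hn => ?_) f
  exact (homZero_shift_right (m := -1 + n) rfl).2 (h G hG _ (by lia))

/-- The objects of `add H⁰` are Ext-projective in the torsion class. -/
lemma isExtProjective_of_addClosure {X : FGModuleCat.{u} A} (hX : addClosure (H0 θ) X) :
    IsExtProjective (torsionClass θ) X := by
  obtain ⟨n, ⟨r⟩⟩ := hX
  refine ⟨HomZero.of_retract_right (HomZero.toDgp_power_right (n := n) hθ.torsionClass_H0)
    (r.map (toDgp A)), fun Y hY => ?_⟩
  exact HomZero.of_retract_left (HomZero.toDgp_power_left (n := n) (hθ.homZero_H0 hY))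
    (r.map (toDgp A))

/-- The morphisms from a two-term complex to modules factor through `H⁰`. -/
lemma exists_comp_map_eq {a : ofModule G₀ ⟶ twoTerm θ} {b : twoTerm θ ⟶ (ofModule G₁)⟦(1 : ℤ)⟧}
    (hT : Triangle.mk ((toDgp A).map θ) a b ∈ distTriang _) {α : twoTerm θ ⟶ ofModule (H0 θ)}
    (hα : a ≫ α = (toDgp A).map (toH0 θ)) {X : FGModuleCat.{u} A} (f : twoTerm θ ⟶ ofModule X) :
    ∃ g : H0 θ ⟶ X, α ≫ (toDgp A).map g = f := by
  obtain ⟨g, hg⟩ := (toDgp_map_bijective hθ.gproj₀ X).2 (a ≫ f)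
  have hθa : (toDgp A).map θ ≫ a = 0 := comp_distTriang_mor_zero₁₂ _ hT
  have hθg : θ ≫ g = 0 := (toDgp_map_bijective hθ.gproj₁ X).1 (by
    rw [Functor.map_comp, hg, Functor.map_zero]
    refine (Category.assoc _ _ _).symm.trans ?_
    exact (congrArg (· ≫ f) hθa).trans zero_comp)
  let g' : H0 θ ⟶ X := FGModuleCat.ofHom ((LinearMap.range θ.hom.hom).liftQ g.hom.hom (by
    rintro _ ⟨x, rfl⟩
    exact congrArg (fun f : G₁ ⟶ X => f.hom.hom x) hθg))
  have hg' : toH0 θ ≫ g' = g := rfl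
  let m : ofModule (H0 θ) ⟶ ofModule X := (toDgp A).map g'
  have hm : a ≫ α ≫ m = a ≫ f := by
    refine (Category.assoc _ _ _).symm.trans ((congrArg (· ≫ m) hα).trans ?_)
    exact ((toDgp A).map_comp _ _).symm.trans hg
  refine ⟨g', sub_eq_zero.1 (?_ : α ≫ m - f = 0)⟩
  -- The two morphisms agree on `G₀`, so their difference factors through `G₁[1]`, which has no
  -- nonzero morphism to a module.
  obtain ⟨c, hc⟩ : ∃ c : (ofModule G₁)⟦(1 : ℤ)⟧ ⟶ ofModule X, α ≫ m - f = b ≫ c :=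
    Triangle.yoneda_exact₃ _ hT (α ≫ m - f)
      ((Preadditive.comp_sub _ _ _).trans (sub_eq_zero.2 hm))
  have hc0 : c = 0 := homZero_zero_iff.1 ((homZero_shift_left (m := -1) (by lia)).2
    (homZero_ofModule_ofModule hθ.gproj₁ X (by lia))) c
  rw [hc, hc0, comp_zero]

end IsPartialGorensteinSilting

end TwoTerm

/-! ### Returning from `D^b_gp(A)` to modules -/

section

variable {A : Type u} [Ring A]

/-- The inclusion of the kernel of `p` and `p` form a `G`-exact sequence if all morphisms from
Gorenstein-projective modules lift along `p`. -/
lemma isGExact_ker {T X : FGModuleCat.{u} A} (p : T ⟶ X)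
    [Module.Finite A (LinearMap.ker p.hom.hom)]
    (h : ∀ G : FGModuleCat.{u} A, gproj A G → ∀ g : G ⟶ X, ∃ l : G ⟶ T, l ≫ p = g) :
    IsGExact (FGModuleCat.ofHom (LinearMap.ker p.hom.hom).subtype :
      FGModuleCat.of A (LinearMap.ker p.hom.hom) ⟶ T) p := by
  refine ⟨⟨Subtype.val_injective, fun x => ⟨fun hx => ⟨⟨x, hx⟩, rfl⟩, ?_⟩, fun x => ?_⟩,
    fun G hG => ⟨fun f g hfg => ?_, fun f => ⟨fun hf => ?_, ?_⟩, h G hG⟩⟩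
  · rintro ⟨y, rfl⟩
    exact y.2
  · obtain ⟨l, hl⟩ := h _ gproj_regular (elementHom x)
    refine ⟨l.hom.hom (1 : A), ?_⟩
    exact (congrArg (fun f : regular A ⟶ X => f.hom.hom (1 : A)) hl).trans (elementHom_apply_one x)
  · ext x
    exact congrArg (fun f : G ⟶ T => f.hom.hom x) hfg
  · exact ⟨FGModuleCat.ofHom (f.hom.hom.codRestrict _ fun x =>
      congrArg (fun f : G ⟶ X => f.hom.hom x) hf), rfl⟩
  · rintro ⟨g, rfl⟩
    ext x
    exact (g.hom.hom x).2

/-- A section in `D^b_gp(A)` of a morphism of modules comes from a section of modules. -/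
lemma exists_section_of_toDgp {T X : FGModuleCat.{u} A} (p : T ⟶ X)
    (σ : (toDgp A).obj X ⟶ (toDgp A).obj T) (hσ : σ ≫ (toDgp A).map p = 𝟙 _) :
    ∃ s : X ⟶ T, s ≫ p = 𝟙 X := by
  have hinj {M : FGModuleCat.{u} A} := (toDgp_map_bijective (gproj_regular (A := A)) M).1
  -- `X` need not be Gorenstein-projective, so `σ` is read off on elements, that is, on morphisms
  -- from `A`. Linearity then follows from faithfulness on morphisms out of `A`.
  have hu (x : X) : ∃ u : T, (toDgp A).map (elementHom u) = (toDgp A).map (elementHom x) ≫ σ := by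
    obtain ⟨u, hu⟩ := (toDgp_map_bijective gproj_regular T).2 ((toDgp A).map (elementHom x) ≫ σ)
    refine ⟨u.hom.hom (1 : A), ?_⟩
    rw [← hu, regular_hom_ext (elementHom_apply_one (u.hom.hom (1 : A)))]
  choose s hs using hu
  have hext {u v : T} (h : (toDgp A).map (elementHom u) = (toDgp A).map (elementHom v)) : u = v :=
    (elementHom_apply_one u).symm.trans
      ((congrArg (fun f : regular A ⟶ T => f.hom.hom (1 : A)) (hinj h)).trans
        (elementHom_apply_one v))
  have hadd {M : FGModuleCat.{u} A} (x y : M) :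
      elementHom (x + y) = elementHom x + elementHom y :=
    regular_hom_ext (by
      refine (elementHom_apply_one _).trans ?_
      exact (congrArg₂ (· + ·) (elementHom_apply_one x) (elementHom_apply_one y)).symm)
  have hsmul {M : FGModuleCat.{u} A} (a : A) (x : M) :
      elementHom (a • x) = elementHom (M := regular A) a ≫ elementHom x :=
    (elementHom_comp (M := regular A) a (elementHom x)).symm
  refine ⟨FGModuleCat.ofHom
    { toFun := s
      map_add' := fun x y => hext ?_
      map_smul' := fun a x => hext ?_ }, ?_⟩
  · rw [hs, hadd, hadd, Functor.map_add, Functor.map_add, hs, hs]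
    exact Preadditive.add_comp _ _ _ _ _ _
  · rw [hs, hsmul]
    refine Eq.trans ?_ (congrArg (toDgp A).map (hsmul a (s x))).symm
    rw [Functor.map_comp, Functor.map_comp, hs]
    exact Category.assoc _ _ _
  · ext x
    have h : elementHom (s x) ≫ p = elementHom x := hinj (by
      rw [Functor.map_comp, hs]
      rw [Category.assoc, hσ, Category.comp_id])
    exact (congrArg (fun f : T => p.hom.hom f) (elementHom_apply_one (s x)).symm).trans
      ((congrArg (fun f : regular A ⟶ X => f.hom.hom (1 : A)) h).trans (elementHom_apply_one x))

end

/-! ### The approximation sequence and the Ext-projectives -/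

namespace IsGorensteinSilting

variable (k : Type*) [Field k] {A : Type u} [Ring A] [Algebra k A] [Module.Finite k A]
  {G₁ G₀ : FGModuleCat.{u} A} {θ : G₁ ⟶ G₀} (hθ : IsGorensteinSilting θ)

include k hθ

/-- A generating family of morphisms to a module in the torsion class also generates the morphisms
from Gorenstein-projective modules. -/
lemma exists_eq_sum {X : FGModuleCat.{u} A} (hX : torsionClass θ X) {n : ℕ}
    {f : Fin n → (twoTerm θ ⟶ ofModule X)} (hf : IsGenerating f) {G : FGModuleCat.{u} A}
    (hG : gproj A G) (g : ofModule G ⟶ ofModule X) :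
    ∃ e : Fin n → (ofModule G ⟶ twoTerm θ), g = ∑ j, e j ≫ f j := by
  refine IsGenerating.exists_eq_sum hθ.posOrthogonal_self (fun i hi =>
    homZero_ofModule_twoTerm hG (by lia) (by lia))
    (exists_finite_family k hθ.gproj₁ hθ.gproj₀) ?_ (hθ.posOrthogonal_ofModule hX) hf g
  rw [hθ.thick_eq]
  exact kbGproj_ofModule hG

/-- The modules in the torsion class are `G`-exact quotients of finite direct sums of copies of
`H⁰`, with kernels in the torsion class. -/
lemma exists_isGExact {X : FGModuleCat.{u} A} (hX : torsionClass θ X) :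
    ∃ (L T₀ : FGModuleCat.{u} A) (i : L ⟶ T₀) (p : T₀ ⟶ X),
      IsGExact i p ∧ addClosure (H0 θ) T₀ ∧ torsionClass θ L := by
  obtain ⟨a, b, α, Z, β, γ, hT, hα, hZ, -⟩ := hθ.exists_toH0_triangle
  obtain ⟨n, f, hf⟩ := exists_finite_family k hθ.gproj₁ hθ.gproj₀ (ofModule X)
  choose g hg using fun j => hθ.exists_comp_map_eq hT hα (f j)
  have hι (j : Fin n) : (toDgp A).map (powerι j) ≫ (toDgp A).map (powerDesc g) =
      (toDgp A).map (g j) := by rw [← Functor.map_comp, powerι_desc]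
  have hlift (G : FGModuleCat.{u} A) (hG : gproj A G) (q : G ⟶ X) :
      ∃ l : G ⟶ power n (H0 θ), l ≫ powerDesc g = q := by
    obtain ⟨e, he⟩ := hθ.exists_eq_sum k hX hf hG ((toDgp A).map q)
    choose h hh using fun j => (toDgp_map_bijective hG (H0 θ)).2 (e j ≫ α)
    refine ⟨∑ j, h j ≫ powerι j, ?_⟩
    simp only [Preadditive.sum_comp, Category.assoc, powerι_desc]
    apply (toDgp_map_bijective hG X).1
    rw [Functor.map_sum]
    refine Eq.trans (Finset.sum_congr rfl fun j _ => ?_) he.symm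
    rw [Functor.map_comp, hh, ← hg j]
    exact Category.assoc _ _ _
  -- Needed for the kernel of `powerDesc g` to be finitely generated.
  have : IsNoetherianRing A := isNoetherian_of_tower k (inferInstance : IsNoetherian k A)
  have hex := isGExact_ker (powerDesc g) hlift
  refine ⟨_, _, _, _, hex, addClosure_power, ?_⟩
  obtain ⟨δ, hδ⟩ := hex.exists_triangle
  -- `Hom(G•, L[1])` vanishes because `Hom(G•, (H⁰)ⁿ[1])` does and every morphism `G• ⟶ X` lifts to
  -- `(H⁰)ⁿ`, being a combination of the `f j`.
  refine (homZero_shift_right (add_zero _)).1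
    (homZero_zero_of_surjective (rot_of_distTriang _ hδ)
      (fun (q : twoTerm θ ⟶ ofModule X) => ?_) (HomZero.toDgp_power_right hθ.torsionClass_H0))
  obtain ⟨e, rfl⟩ := hf q
  let m (j : Fin n) : ofModule (H0 θ) ⟶ ofModule (power n (H0 θ)) := (toDgp A).map (powerι j)
  let d : ofModule (power n (H0 θ)) ⟶ ofModule X := (toDgp A).map (powerDesc g)
  have hm (j : Fin n) : α ≫ m j ≫ d = f j := (congrArg (α ≫ ·) (hι j)).trans (hg j)
  refine ⟨∑ j, e j ≫ α ≫ m j, (?_ : (∑ j, e j ≫ α ≫ m j) ≫ d = _)⟩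
  simp only [Preadditive.sum_comp, Category.assoc, hm]

/-- The Ext-projective modules of the torsion class lie in `add H⁰`. -/
lemma addClosure_of_isExtProjective {X : FGModuleCat.{u} A}
    (hX : IsExtProjective (torsionClass θ) X) : addClosure (H0 θ) X := by
  obtain ⟨L, T₀, i, p, hex, ⟨n, ⟨r⟩⟩, hL⟩ := hθ.exists_isGExact k hX.1
  obtain ⟨δ, hδ⟩ := hex.exists_triangle
  -- The connecting morphism `δ` is zero, since `L` lies in the torsion class and `X` is
  -- Ext-projective there.
  obtain ⟨σ, hσ⟩ : ∃ σ : ofModule X ⟶ ofModule T₀, 𝟙 (ofModule X) = σ ≫ (toDgp A).map p :=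
    Triangle.coyoneda_exact₃ _ hδ (𝟙 (ofModule X)) ((congrArg _ (hX.2 L hL δ)).trans comp_zero)
  obtain ⟨s, hs⟩ := exists_section_of_toDgp p σ hσ.symm
  exact ⟨n, ⟨(Retract.mk s p hs).trans r⟩⟩

end IsGorensteinSilting

end GorensteinSilting

end

open GorensteinSilting in
theorem proposition3p10 (k : Type*) [Field k] {A : Type u} [Ring A] [Algebra k A]
    [Module.Finite k A] {G₁ G₀ : FGModuleCat.{u} A} (θ : G₁ ⟶ G₀)
    (hθ : IsGorensteinSilting θ) :
    (∀ X : FGModuleCat.{u} A,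
      addClosure (H0 θ) X ↔ IsExtProjective (torsionClass θ) X) ∧
    (∀ X : FGModuleCat.{u} A, torsionClass θ X →
      ∃ (L T₀ : FGModuleCat.{u} A) (i : L ⟶ T₀) (p : T₀ ⟶ X),
        IsGExact i p ∧ addClosure (H0 θ) T₀ ∧ torsionClass θ L) := by
  exact ⟨fun X => ⟨hθ.isExtProjective_of_addClosure, hθ.addClosure_of_isExtProjective k⟩,
    fun X hX => hθ.exists_isGExact k hX⟩
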